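/- For a Lebesgue measurable set $E\subset\mathbb{R}^N$ ($N\ge 2$) let $|E|$ be its Lebesgue measure and $$P(E)=\sup\Big\{\int_E \operatorname{div}\varphi\,dx:\ \varphi\in C^1_c(\mathbb{R}^N;\mathbb{R}^N),\ |\varphi|\le 1\Big\}\in[0,+\infty]$$ its distributional perimeter. For a bounded measurable set $\Omega\subset\mathbb{R}^N$ and $k\ge 1$ let $$h_k(\Omega)=\inf\ \max_{1\le i\le k}\frac{P(E_i)}{|E_i|}\in[0,+\infty],$$ where the infimum is taken over all $k$-tuples $(E_1,\dots,E_k)$ of mutually disjoint measurable subsets of $\Omega$ with $|E_i|>0$ for all $i$. A $k$-tuple of this kind that attains the infimum is called a minimizer of $h_k(\Omega)$ (if $h_k(\Omega)=+\infty$, every such $k$-tuple attains it). For $n\in\{1,\dots,k\}$, a minimizer $(E_1,\dots,E_k)$ of $h_k(\Omega)$ is called an $n$-adjusted Cheeger $k$-tuple of $\Omega$ if for every $l\in\{1,\dots,n\}$ and all mutually different $i_1,\dots,i_l\in\{1,\dots,k\}$ $$h_l\Big(\Omega\setminus\bigcup_{j\ne i_1,\dots,i_l}E_j\Big)=h_l\big(E_{i_1}\cup\dots\cup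 E_{i_l}\big)=\max\Big\{\frac{P(E_{i_1})}{|E_{i_1}|},\dots,\frac{P(E_{i_l})}{|E_{i_l}|}\Big\},$$ that is, every sub-$l$-tuple $(E_{i_1},\dots,E_{i_l})$ with $l\le n$ is a minimizer of $h_l$ of $\Omega$ with the other sets removed. **Theorem.** Let $N\ge 2$ and let $\Omega\subset\mathbb{R}^N$ be a bounded measurable set with $|\Omega|>0$. Then for every integer $k\ge 1$ and every $n\in\{1,\dots,k\}$ there exists an $n$-adjusted Cheeger $k$-tuple of $\Omega$. -/

import Mathlib

open MeasureTheory Set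

open scoped ENNReal

namespace Cheeger

noncomputable section

/-- The divergence `∑ i, ∂φ_i/∂x_i` of a vector field on `ℝ^N`. -/
def divergence {N : ℕ} (φ : EuclideanSpace ℝ (Fin N) → EuclideanSpace ℝ (Fin N))
    (x : EuclideanSpace ℝ (Fin N)) : ℝ :=
  ∑ i : Fin N, (fderiv ℝ φ x (EuclideanSpace.single i 1)) i

/-- The distributional perimeter `P(E) = P(E; ℝ^N)`: the supremum of `∫_E div φ` over all compactly
supported `C¹` vector fields `φ` with `|φ| ≤ 1` (Euclidean norm); it may be `+∞`. As `φ = 0` is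
admitted, truncating the integrals at `0` does not change the supremum. -/
def perimeter {N : ℕ} (E : Set (EuclideanSpace ℝ (Fin N))) : ℝ≥0∞ :=
  ⨆ (φ : EuclideanSpace ℝ (Fin N) → EuclideanSpace ℝ (Fin N)) (_ : ContDiff ℝ 1 φ)
    (_ : HasCompactSupport φ) (_ : ∀ x, ‖φ x‖ ≤ 1),
    ENNReal.ofReal (∫ x in E, divergence φ x)

/-- The quotient `P(E) / |E|` in `[0, +∞]` (used for sets with `0 < |E| < ∞`). -/
def ratio {N : ℕ} (E : Set (EuclideanSpace ℝ (Fin N))) : ℝ≥0∞ :=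
  perimeter E / volume E

/-- The `k`-tuples of mutually disjoint Lebesgue measurable subsets of `Ω` with positive Lebesgue
measure. -/
structure IsAdmissible {N k : ℕ} (Ω : Set (EuclideanSpace ℝ (Fin N)))
    (E : Fin k → Set (EuclideanSpace ℝ (Fin N))) : Prop where
  subset : ∀ i, E i ⊆ Ω
  measurable : ∀ i, NullMeasurableSet (E i) volume
  pos : ∀ i, 0 < volume (E i)
  disjoint : Pairwise fun i j => Disjoint (E i) (E j)

/-- The `k`-th Cheeger constant `h_k(Ω)`, as an element of `[0, +∞]`. -/
def cheegerConst {N : ℕ} (k : ℕ) (Ω : Set (EuclideanSpace ℝ (Fin N))) : ℝ≥0∞ :=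
  ⨅ (E : Fin k → Set (EuclideanSpace ℝ (Fin N))) (_ : IsAdmissible Ω E), ⨆ i, ratio (E i)

/-- A Cheeger `k`-tuple of `Ω`: a minimizer of `h_k(Ω)`. -/
def IsCheegerTuple {N k : ℕ} (Ω : Set (EuclideanSpace ℝ (Fin N)))
    (E : Fin k → Set (EuclideanSpace ℝ (Fin N))) : Prop :=
  IsAdmissible Ω E ∧ ⨆ i, ratio (E i) = cheegerConst k Ω

/-- `IsAdjusted Ω E n`: the tuple `E = (E_1, …, E_k)` is an `n`-adjusted Cheeger `k`-tuple of `Ω`.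
The recursion starts from `n = 0`, which just means that `E` is a minimizer of `h_k(Ω)`. A choice
of mutually different indices `i_1, …, i_n` is an injective map `σ : Fin n → Fin k`. -/
def IsAdjusted {N k : ℕ} (Ω : Set (EuclideanSpace ℝ (Fin N)))
    (E : Fin k → Set (EuclideanSpace ℝ (Fin N))) : ℕ → Prop
  | 0 => IsCheegerTuple Ω E
  | n + 1 => IsAdjusted Ω E n ∧
      ∀ σ : Fin (n + 1) → Fin k, Function.Injective σ →
        cheegerConst (n + 1) (Ω \ ⋃ j ∈ (range σ)ᶜ, E j)
            = cheegerConst (n + 1) (⋃ i, E (σ i)) ∧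
        cheegerConst (n + 1) (⋃ i, E (σ i)) = ⨆ i, ratio (E (σ i))

end

end Cheeger

/-!
The adjusted tuple is a lexicographic minimizer: among the admissible `k`-tuples in `Ω`, choose one
that first minimizes the largest quotient `P(E_i) / |E_i|`, then the second largest, and so on.
If a subtuple could be improved in the complement of the other sets, that is, if its largest
quotient could be lowered, then replacing it would not change the quotients outside the subtuple
and would make the ordered list of all quotients lexicographically smaller
(`exists_lexicographic_min`, `IsAdmissible.extend`). So no subtuple of any length can be improved,
and this is what `n`-adjustedness says for every `n` (`isAdjusted_of_forall_le`).

The minimizer exists because the competitors with quotients at most `C` form a compact subset of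
`(L¹)^k` (`isCompact_competitors`) on which the quotients are lower semicontinuous, as suprema of
continuous functions (`lowerSemicontinuousOn_quotient`). The compactness estimates are deduced
from the translation estimate `|E \ (E - h)| ≤ |h| P(E)` (`volume_translate_diff_le`). Averaging it
over a ball gives a weak isoperimetric inequality (`volume_le_mul_perimeter`), by which sets with
quotient at most `C` cannot shrink to null sets, and shows that a set of bounded perimeter is
determined up to a small measure by its measures in finitely many small balls, hence the total
boundedness in `L¹` (`totallyBounded_chi`). Closedness holds since "`f` is the characteristic
function of a subset of `Ω`" is the closed condition `min(f, 1_Ω - f) = 0`.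

This needs one admissible tuple with finite quotients. If some subset of `Ω` of positive measure has
finite perimeter, it is cut by hyperplanes into `k` such sets (`exists_cut`). Otherwise all
quotients are infinite and every admissible tuple is adjusted.
-/

namespace Cheeger

/-! ### Lexicographic minimization -/

/-- Finitely many lower semicontinuous functions can be minimized successively on a compact set,
each one on the set of minimizers of the preceding ones. -/
theorem exists_successive_min {X : Type*} [TopologicalSpace X] (n : ℕ) :
    ∀ (K : Set X) (Ψ : ℕ → X → ℝ≥0∞), IsCompact K → K.Nonempty →
      (∀ j, LowerSemicontinuousOn (Ψ j) K) →
      ∃ x ∈ K, ∀ y ∈ K, ∀ j < n, (∀ i < j, Ψ i y ≤ Ψ i x) → Ψ j x ≤ Ψ j y := by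
  induction n with
  | zero =>
    rintro K Ψ - ⟨x, hx⟩ -
    exact ⟨x, hx, fun y _ j hj => absurd hj (Nat.not_lt_zero j)⟩
  | succ n ih =>
    intro K Ψ hK hne hΨ
    obtain ⟨x₀, hx₀, hmin⟩ := (hΨ 0).exists_isMinOn hne hK
    have hK' : IsCompact (K ∩ Ψ 0 ⁻¹' Iic (Ψ 0 x₀)) :=
      (hΨ 0).isCompact_inter_preimage_Iic hK _
    obtain ⟨x, hx, hmin'⟩ := ih (K ∩ Ψ 0 ⁻¹' Iic (Ψ 0 x₀)) (fun j => Ψ (j + 1)) hK'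
      ⟨x₀, hx₀, le_refl (Ψ 0 x₀)⟩ (fun j => (hΨ (j + 1)).mono inter_subset_left)
    refine ⟨x, hx.1, fun y hy j hj hle => ?_⟩
    cases j with
    | zero => exact le_trans hx.2 (hmin hy)
    | succ j =>
      refine hmin' y ⟨hy, (hle 0 j.succ_pos).trans hx.2⟩ j (by omega) fun i hi => ?_
      exact hle (i + 1) (by omega)

/-- The `(j + 1)`-st largest of the numbers `v i`, counted with multiplicity (and `0` if there are
at most `j` of them). -/
noncomputable def nthLargest {ι : Type*} [Fintype ι] (j : ℕ) (v : ι → ℝ≥0∞) : ℝ≥0∞ :=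
  (Finset.powersetCard (j + 1) Finset.univ).sup fun T : Finset ι => T.inf v

theorem lowerSemicontinuousOn_finset_inf {X ι : Type*} [TopologicalSpace X] {K : Set X}
    {r : ι → X → ℝ≥0∞} (hr : ∀ i, LowerSemicontinuousOn (r i) K) (T : Finset ι) :
    LowerSemicontinuousOn (fun x => T.inf fun i => r i x) K := by
  classical
  induction T using Finset.induction_on with
  | empty => simpa using lowerSemicontinuousOn_const
  | insert a T _ ih => simpa [Finset.inf_insert] using (hr a).inf ih

theorem lowerSemicontinuousOn_nthLargest {X ι : Type*} [TopologicalSpace X] [Fintype ι] {K : Set X}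
    {r : ι → X → ℝ≥0∞} (hr : ∀ i, LowerSemicontinuousOn (r i) K) (j : ℕ) :
    LowerSemicontinuousOn (fun x => nthLargest j fun i => r i x) K := by
  simp only [nthLargest, Finset.sup_eq_iSup]
  exact lowerSemicontinuousOn_biSup fun T _ => lowerSemicontinuousOn_finset_inf hr T

/-- A minimizer of the decreasingly ordered values `r i x`, in the lexicographic order, cannot be
improved on any subset `s` of the indices: a competitor that agrees with it off `s` has on `s` a
maximum that is at least as large. -/
theorem exists_lexicographic_min {X ι : Type*} [TopologicalSpace X] [Fintype ι] {K : Set X}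
    (hK : IsCompact K) (hne : K.Nonempty) {r : ι → X → ℝ≥0∞}
    (hr : ∀ i, LowerSemicontinuousOn (r i) K) :
    ∃ x ∈ K, ∀ y ∈ K, ∀ (s : Set ι) (M : ℝ≥0∞), (∀ i ∉ s, r i y = r i x) →
      (∀ i ∈ s, r i y < M) → ∀ i ∈ s, r i x < M := by
  classical
  obtain ⟨x, hx, hmin⟩ := exists_successive_min (Fintype.card ι) K
    (fun j x => nthLargest j fun i => r i x) hK hne
    (fun j => lowerSemicontinuousOn_nthLargest hr j)
  refine ⟨x, hx, fun y hy s M₀ hoff hlt i₀ hi₀ => ?_⟩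
  by_contra hcon
  push Not at hcon
  -- the largest value of `x` on `s`
  obtain ⟨i₁, hi₁, hmax⟩ := Finset.exists_max_image (Finset.univ.filter (· ∈ s)) (fun i => r i x)
    ⟨i₀, by simpa using hi₀⟩
  simp only [Finset.mem_filter, Finset.mem_univ, true_and] at hi₁ hmax
  set M := r i₁ x with hM
  have hlt' : ∀ i ∈ s, r i y < M := fun i hi => (hlt i hi).trans_le (hcon.trans (hmax i₀ hi₀))
  -- The values above `M` are taken off `s`, so `x` and `y` have them in common, while `y` takes
  -- values `≥ M` less often than `x`: the ordered values of `y` are lexicographically smaller.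
  set A := Finset.univ.filter fun i => M ≤ r i x with hA
  set B := Finset.univ.filter fun i => M ≤ r i y with hB
  have hBA : B ⊂ A := by
    refine Finset.ssubset_iff_subset_ne.2 ⟨fun i hi => ?_, fun h => ?_⟩
    · simp only [hA, hB, Finset.mem_filter, Finset.mem_univ, true_and] at hi ⊢
      by_cases his : i ∈ s
      · exact absurd hi (not_le.2 (hlt' i his))
      · rwa [← hoff i his]
    · have : i₁ ∈ B := by rw [h]; simp [hA, hM]
      simp only [hB, Finset.mem_filter, Finset.mem_univ, true_and] at this
      exact absurd this (not_le.2 (hlt' i₁ hi₁))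
  have hcard : B.card < A.card := Finset.card_lt_card hBA
  have hA1 : A.card = A.card - 1 + 1 := by omega
  have hAcard : A.card ≤ Fintype.card ι := Finset.card_le_univ A
  have hle : ∀ i < A.card - 1, nthLargest i (fun l => r l y) ≤ nthLargest i fun l => r l x := by
    intro i hi
    refine Finset.sup_le fun T hT => ?_
    rw [Finset.mem_powersetCard] at hT
    have hTne : T.Nonempty := Finset.card_pos.1 (by omega)
    by_cases hTs : ∀ l ∈ T, l ∉ s
    · refine le_trans (le_of_eq (Finset.inf_congr rfl fun l hl => hoff l (hTs l hl))) ?_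
      exact Finset.le_sup (f := fun T : Finset ι => T.inf fun l => r l x)
        (Finset.mem_powersetCard.2 hT)
    · push Not at hTs
      obtain ⟨l, hl, hls⟩ := hTs
      obtain ⟨T', hT'A, hT'⟩ := Finset.exists_subset_card_eq (s := A) (n := i + 1) (by omega)
      calc (T.inf fun l => r l y) ≤ r l y := Finset.inf_le hl
        _ ≤ M := (hlt' l hls).le
        _ ≤ T'.inf fun l => r l x := Finset.le_inf fun l hl => (Finset.mem_filter.1 (hT'A hl)).2
        _ ≤ _ := Finset.le_sup (f := fun T : Finset ι => T.inf fun l => r l x)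
          (Finset.mem_powersetCard.2 ⟨Finset.subset_univ _, hT'⟩)
  have hkey := hmin y hy (A.card - 1) (by omega) hle
  have h1 : M ≤ nthLargest (A.card - 1) fun l => r l x :=
    le_trans (Finset.le_inf fun l hl => (Finset.mem_filter.1 hl).2)
      (Finset.le_sup (f := fun T : Finset ι => T.inf fun l => r l x)
        (Finset.mem_powersetCard.2 ⟨Finset.subset_univ A, hA1⟩))
  have h2 : nthLargest (A.card - 1) (fun l => r l y) < M := by
    refine (Finset.sup_lt_iff (bot_le.trans_lt (hlt' i₁ hi₁))).2 fun T hT => ?_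
    rw [Finset.mem_powersetCard] at hT
    have : ¬ T ⊆ B := fun h => by have := Finset.card_le_card h; omega
    obtain ⟨l, hlT, hlB⟩ := Finset.not_subset.1 this
    refine (Finset.inf_le hlT).trans_lt ?_
    simpa [hB] using hlB
  exact absurd (h1.trans hkey) (not_le.2 h2)

/-! ### Vector fields and the perimeter -/

section VectorFields

variable {N : ℕ}

theorem divergence_smul {η : EuclideanSpace ℝ (Fin N) → ℝ}
    {φ : EuclideanSpace ℝ (Fin N) → EuclideanSpace ℝ (Fin N)} {x : EuclideanSpace ℝ (Fin N)}
    (hη : DifferentiableAt ℝ η x) (hφ : DifferentiableAt ℝ φ x) :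
    divergence (fun y => η y • φ y) x = η x * divergence φ x + fderiv ℝ η x (φ x) := by
  have h1 : fderiv ℝ η x (φ x)
      = ∑ i, fderiv ℝ η x (EuclideanSpace.single i 1) * (φ x) i := by
    conv_lhs => rw [← (EuclideanSpace.basisFun (Fin N) ℝ).sum_repr (φ x)]
    simp [mul_comm]
  rw [h1, divergence, divergence, Finset.mul_sum, ← Finset.sum_add_distrib]
  refine Finset.sum_congr rfl fun i _ => ?_
  rw [fderiv_fun_smul hη hφ]
  simp

theorem divergence_const (v x : EuclideanSpace ℝ (Fin N)) : divergence (fun _ => v) x = 0 := by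
  simp [divergence]

theorem continuous_divergence {φ : EuclideanSpace ℝ (Fin N) → EuclideanSpace ℝ (Fin N)}
    (hφ : ContDiff ℝ 1 φ) : Continuous (divergence φ) := by
  have h : Continuous (fderiv ℝ φ) := hφ.continuous_fderiv one_ne_zero
  unfold divergence
  fun_prop

theorem hasCompactSupport_divergence {φ : EuclideanSpace ℝ (Fin N) → EuclideanSpace ℝ (Fin N)}
    (hφ : HasCompactSupport φ) : HasCompactSupport (divergence φ) := by
  refine (hφ.fderiv ℝ).mono fun x hx => ?_
  contrapose! hx
  simp only [Function.mem_support, ne_eq, not_not] at hx ⊢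
  simp [divergence, hx]

theorem integrable_divergence {φ : EuclideanSpace ℝ (Fin N) → EuclideanSpace ℝ (Fin N)}
    (hφ : ContDiff ℝ 1 φ) (hc : HasCompactSupport φ) : Integrable (divergence φ) volume :=
  (continuous_divergence hφ).integrable_of_hasCompactSupport (hasCompactSupport_divergence hc)

theorem perimeter_congr {E F : Set (EuclideanSpace ℝ (Fin N))} (h : E =ᵐ[volume] F) :
    perimeter E = perimeter F := by
  simp only [perimeter, setIntegral_congr_set h]

theorem ofReal_integral_divergence_le_perimeter (E : Set (EuclideanSpace ℝ (Fin N)))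
    {φ : EuclideanSpace ℝ (Fin N) → EuclideanSpace ℝ (Fin N)}
    (hφ : ContDiff ℝ 1 φ) (hc : HasCompactSupport φ) (h1 : ∀ x, ‖φ x‖ ≤ 1) :
    ENNReal.ofReal (∫ x in E, divergence φ x) ≤ perimeter E :=
  le_iSup₂_of_le φ hφ (le_iSup₂_of_le hc h1 le_rfl)

theorem integral_divergence_le_perimeter {E : Set (EuclideanSpace ℝ (Fin N))}
    (hE : perimeter E ≠ ∞) {φ : EuclideanSpace ℝ (Fin N) → EuclideanSpace ℝ (Fin N)}
    (hφ : ContDiff ℝ 1 φ) (hc : HasCompactSupport φ) (h1 : ∀ x, ‖φ x‖ ≤ 1) :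
    ∫ x in E, divergence φ x ≤ (perimeter E).toReal :=
  (ENNReal.ofReal_le_iff_le_toReal hE).1 (ofReal_integral_divergence_le_perimeter E hφ hc h1)

end VectorFields

/-! ### Translations of a set of finite perimeter -/

section Translation

variable {N : ℕ}

/-- Along a line, `s ↦ ∫_E g(x + s h) dx` has the derivative `∫_E div φ`, where
`φ(x) = g(x + s h) h`. -/
theorem integral_comp_add_sub_integral_le {E : Set (EuclideanSpace ℝ (Fin N))}
    (hvol : volume E ≠ ∞) (hE : perimeter E ≠ ∞) {g : EuclideanSpace ℝ (Fin N) → ℝ}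
    (hg : ContDiff ℝ 1 g) (hc : HasCompactSupport g) (h1 : ∀ x, |g x| ≤ 1)
    (h : EuclideanSpace ℝ (Fin N)) :
    (∫ x in E, g (x + h)) - ∫ x in E, g x ≤ ‖h‖ * (perimeter E).toReal := by
  rcases eq_or_ne h 0 with rfl | hh
  · simp
  have hfin : IsFiniteMeasure (volume.restrict E) := ⟨by simpa using hvol.lt_top⟩
  have hcont : Continuous (fderiv ℝ g) := hg.continuous_fderiv one_ne_zero
  obtain ⟨C, hC⟩ := (hc.fderiv ℝ).exists_bound_of_continuous hcont
  have hdiff : ∀ (x : EuclideanSpace ℝ (Fin N)) (s : ℝ),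
      HasDerivAt (fun s : ℝ => g (x + s • h)) (fderiv ℝ g (x + s • h) h) s := by
    intro x s
    have h2 : HasDerivAt (fun s : ℝ => x + s • h) h s := by
      simpa using ((hasDerivAt_id s).smul_const h).const_add x
    exact ((hg.differentiable one_ne_zero) (x + s • h)).hasFDerivAt.comp_hasDerivAt s h2
  have hder : ∀ s : ℝ, HasDerivAt (fun s : ℝ => ∫ x in E, g (x + s • h))
      (∫ x in E, fderiv ℝ g (x + s • h) h) s := by
    intro s
    refine (hasDerivAt_integral_of_dominated_loc_of_deriv_le (s := univ)
      (μ := volume.restrict E) (F := fun s x => g (x + s • h))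
      (F' := fun s x => fderiv ℝ g (x + s • h) h) (x₀ := s)
      (bound := fun _ => C * ‖h‖) Filter.univ_mem ?_ ?_ ?_ ?_ ?_ ?_).2
    · refine Filter.Eventually.of_forall fun s => ?_
      exact (hg.continuous.comp (by fun_prop)).aestronglyMeasurable
    · have hgi : Integrable g volume := hg.continuous.integrable_of_hasCompactSupport hc
      exact (hgi.comp_add_right (s • h)).integrableOn
    · exact (((hcont.comp (by fun_prop :
        Continuous fun x : EuclideanSpace ℝ (Fin N) => x + s • h)).clm_apply
        continuous_const)).aestronglyMeasurable
    · refine Filter.Eventually.of_forall fun x s _ => ?_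
      exact (ContinuousLinearMap.le_opNorm _ _).trans (by gcongr; exact hC _)
    · exact integrable_const _
    · exact Filter.Eventually.of_forall fun x s _ => hdiff x s
  have hbound : ∀ s : ℝ, deriv (fun s : ℝ => ∫ x in E, g (x + s • h)) s
      ≤ ‖h‖ * (perimeter E).toReal := by
    intro s
    rw [(hder s).deriv]
    have hgs : ContDiff ℝ 1 fun x => g (x + s • h) := hg.comp (by fun_prop)
    have hkey := integral_divergence_le_perimeter hE
      (φ := fun x => g (x + s • h) • (‖h‖⁻¹ • h)) (hgs.smul contDiff_const)
      ((hc.comp_homeomorph (Homeomorph.addRight (s • h))).smul_right) (fun x => by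
        have : ‖h‖ ≠ 0 := norm_ne_zero_iff.2 hh
        rw [norm_smul, norm_smul, norm_inv, norm_norm, inv_mul_cancel₀ this, mul_one]
        exact h1 _)
    have hdiv : ∀ x, divergence (fun x => g (x + s • h) • (‖h‖⁻¹ • h)) x
        = ‖h‖⁻¹ * fderiv ℝ g (x + s • h) h := by
      intro x
      rw [divergence_smul (hgs.differentiable one_ne_zero x) (differentiableAt_const _),
        divergence_const, mul_zero, zero_add, fderiv_comp_add_right, map_smul, smul_eq_mul]
    simp only [hdiv] at hkey
    rw [integral_const_mul, inv_mul_le_iff₀ (norm_pos_iff.2 hh)] at hkey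
    exact hkey
  have := image_sub_le_mul_sub_of_deriv_le
    (fun s => (hder s).differentiableAt) hbound zero_le_one
  simpa using this

/-- The translation estimate: a set of finite perimeter moves by at most `‖h‖ P(E)` in measure under
the translation by `h`. -/
theorem volume_translate_diff_le {E : Set (EuclideanSpace ℝ (Fin N))} (hm : MeasurableSet E)
    (hvol : volume E ≠ ∞) (h : EuclideanSpace ℝ (Fin N)) :
    volume {x | x ∈ E ∧ x + h ∉ E} ≤ ENNReal.ofReal ‖h‖ * perimeter E := by
  rcases eq_or_ne h 0 with rfl | hh
  · simp
  by_cases hE : perimeter E = ∞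
  · rw [hE, ENNReal.mul_top (by simpa using hh)]
    exact le_top
  set A : Set (EuclideanSpace ℝ (Fin N)) := {x | x - h ∈ E ∧ x ∉ E} with hA
  have hEh : MeasurableSet ((fun x => x - h) ⁻¹' E) := (measurable_sub_const h) hm
  have hAm : MeasurableSet A := hEh.diff hm
  have hAE : volume {x | x ∈ E ∧ x + h ∉ E} = volume A := by
    rw [← measure_preimage_add_right volume h A]
    simp [hA]
  have hAfin : volume A ≠ ∞ := by
    rw [← hAE]
    exact ne_top_of_le_ne_top hvol (measure_mono fun x hx => hx.1)
  rw [hAE]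
  refine ENNReal.le_of_forall_pos_le_add fun ε hε _ => ?_
  -- compact and open approximations of `A` and a cutoff function between them
  obtain ⟨K, hKA, hK, hKvol⟩ := hAm.exists_isCompact_sdiff_lt hAfin
    (ε := ((ε / 2 : NNReal) : ℝ≥0∞)) (by simpa using hε.ne')
  obtain ⟨U, hKU, hU, hUvol⟩ := K.exists_isOpen_lt_add (μ := volume) hK.measure_lt_top.ne
    (ε := ((ε / 2 : NNReal) : ℝ≥0∞)) (by simpa using hε.ne')
  obtain ⟨R, hR⟩ := hK.isBounded.subset_ball (0 : EuclideanSpace ℝ (Fin N))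
  obtain ⟨g, hgd, hgr, hgs, hg1⟩ := exists_contMDiff_support_eq_eq_one_iff
    (modelWithCornersSelf ℝ (EuclideanSpace ℝ (Fin N))) (n := 1)
    (hU.inter Metric.isOpen_ball) hK.isClosed (subset_inter hKU hR)
  have hgC : ContDiff ℝ 1 g := hgd.contDiff
  have hg01 : ∀ x, 0 ≤ g x ∧ g x ≤ 1 := fun x => hgr (mem_range_self x)
  have hgc : HasCompactSupport g :=
    HasCompactSupport.intro (isCompact_closedBall (0 : EuclideanSpace ℝ (Fin N)) R) fun x hx => by
      by_contra hne
      have : x ∈ Function.support g := hne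
      rw [hgs] at this
      exact hx (Metric.ball_subset_closedBall this.2)
  have hgi : Integrable g volume := hgC.continuous.integrable_of_hasCompactSupport hgc
  have hkey := integral_comp_add_sub_integral_le hvol hE hgC hgc
    (fun x => abs_le.2 ⟨by linarith [(hg01 x).1], (hg01 x).2⟩) h
  have hUK : volume (U \ K) ≤ ((ε / 2 : NNReal) : ℝ≥0∞) := by
    rw [measure_sdiff hKU hK.measurableSet.nullMeasurableSet hK.measure_lt_top.ne]
    exact tsub_le_iff_left.2 hUvol.le
  have hUKfin : volume (U \ K) ≠ ∞ := ne_top_of_le_ne_top ENNReal.coe_ne_top hUK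
  have hlow : volume.real K ≤ ∫ x in E, g (x + h) := by
    have h2 : ∫ x in E, g (x + h) = ∫ x in (fun x => x - h) ⁻¹' E, g x := by
      have := (measurePreserving_add_right volume h).setIntegral_preimage_emb
        (measurableEmbedding_addRight h) g ((fun x => x - h) ⁻¹' E)
      rw [← this]
      congr 2
      ext x
      simp
    rw [h2]
    calc volume.real K = ∫ x in K, g x := by
          rw [setIntegral_congr_fun hK.measurableSet (fun x hx => (hg1 x).1 hx)]
          simp
      _ ≤ ∫ x in (fun x => x - h) ⁻¹' E, g x :=
          setIntegral_mono_set hgi.integrableOn (Filter.Eventually.of_forall fun x => (hg01 x).1)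
            (Filter.Eventually.of_forall fun x hx => (hKA hx).1)
  have hupp : ∫ x in E, g x ≤ volume.real (U \ K) := by
    have h2 : ∫ x in E, g x = ∫ x in E ∩ (U \ K), g x := by
      refine setIntegral_eq_of_subset_of_forall_sdiff_eq_zero (f := g) (μ := volume) hm
        inter_subset_left ?_
      intro x hx
      by_contra hne
      have hxs : x ∈ Function.support g := hne
      rw [hgs] at hxs
      exact hx.2 ⟨hx.1, hxs.1, fun hxK => (hKA hxK).2 hx.1⟩
    rw [h2]
    calc ∫ x in E ∩ (U \ K), g x ≤ ∫ x in U \ K, g x :=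
          setIntegral_mono_set hgi.integrableOn (Filter.Eventually.of_forall fun x => (hg01 x).1)
            (Filter.Eventually.of_forall fun x hx => hx.2)
      _ ≤ ∫ x in U \ K, (1 : ℝ) :=
          setIntegral_mono hgi.integrableOn (integrableOn_const hUKfin) fun x => (hg01 x).2
      _ = volume.real (U \ K) := by simp
  have hKle : volume K ≤ ENNReal.ofReal ‖h‖ * perimeter E + volume (U \ K) := by
    rw [← ENNReal.ofReal_toReal hE, ← ENNReal.ofReal_mul (norm_nonneg h),
      ← ENNReal.ofReal_toReal hUKfin, ← ENNReal.ofReal_add (by positivity) (by positivity),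
      ← ENNReal.ofReal_toReal hK.measure_lt_top.ne]
    refine ENNReal.ofReal_le_ofReal ?_
    change volume.real K ≤ _ + volume.real (U \ K)
    linarith
  calc volume A ≤ volume K + volume (A \ K) := by
        rw [← measure_union disjoint_sdiff_right (hAm.diff hK.measurableSet)]
        exact measure_mono (by rw [union_sdiff_self]; exact subset_union_right)
    _ ≤ (ENNReal.ofReal ‖h‖ * perimeter E + ((ε / 2 : NNReal) : ℝ≥0∞))
        + ((ε / 2 : NNReal) : ℝ≥0∞) := by gcongr; exact hKle.trans (by gcongr)
    _ = ENNReal.ofReal ‖h‖ * perimeter E + ε := by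
        rw [add_assoc, ← ENNReal.coe_add, add_halves]

/-- The translation estimate, averaged over the vectors of length less than `r`. -/
theorem lintegral_volume_ball_diff_le {E : Set (EuclideanSpace ℝ (Fin N))} (hm : MeasurableSet E)
    (hvol : volume E ≠ ∞) (r : ℝ) :
    ∫⁻ x in E, volume (Metric.ball x r \ E) ≤
      volume (Metric.ball (0 : EuclideanSpace ℝ (Fin N)) r) *
        (ENNReal.ofReal r * perimeter E) := by
  have hS : MeasurableSet
      {p : EuclideanSpace ℝ (Fin N) × EuclideanSpace ℝ (Fin N) | p.1 + p.2 ∉ E} :=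
    (measurable_fst.add measurable_snd) hm.compl
  have h1 : ∀ x : EuclideanSpace ℝ (Fin N), volume (Metric.ball x r \ E)
      = ∫⁻ h in Metric.ball (0 : EuclideanSpace ℝ (Fin N)) r,
        {p : EuclideanSpace ℝ (Fin N) × EuclideanSpace ℝ (Fin N) | p.1 + p.2 ∉ E}.indicator
          (fun _ => 1) (x, h) := by
    intro x
    have : (fun h => {p : EuclideanSpace ℝ (Fin N) × EuclideanSpace ℝ (Fin N) |
        p.1 + p.2 ∉ E}.indicator (fun _ => (1 : ℝ≥0∞)) (x, h))
        = {h | x + h ∉ E}.indicator 1 := by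
      ext h; simp [indicator]
    have hmeas : MeasurableSet {h | x + h ∉ E} := (measurable_const_add x) hm.compl
    rw [this, lintegral_indicator_one hmeas, Measure.restrict_apply hmeas,
      ← measure_preimage_add volume x]
    congr 1
    ext h
    simp [and_comm]
  simp only [h1]
  rw [lintegral_lintegral_swap (f := fun x h => {p : EuclideanSpace ℝ (Fin N) ×
    EuclideanSpace ℝ (Fin N) | p.1 + p.2 ∉ E}.indicator (fun _ => (1 : ℝ≥0∞)) (x, h))
    (measurable_const.indicator hS).aemeasurable]
  calc _ ≤ ∫⁻ h in Metric.ball (0 : EuclideanSpace ℝ (Fin N)) r,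
        ENNReal.ofReal r * perimeter E := by
        refine setLIntegral_mono measurable_const fun h hh => ?_
        have hmeas : MeasurableSet {x | x + h ∉ E} := (measurable_add_const h) hm.compl
        have : (fun x => {p : EuclideanSpace ℝ (Fin N) × EuclideanSpace ℝ (Fin N) |
            p.1 + p.2 ∉ E}.indicator (fun _ => (1 : ℝ≥0∞)) (x, h))
            = {x | x + h ∉ E}.indicator 1 := by
          ext x; simp [indicator]
        rw [this, lintegral_indicator_one hmeas, Measure.restrict_apply hmeas]
        have hle := volume_translate_diff_le hm hvol h
        rw [show {x | x + h ∉ E} ∩ E = {x | x ∈ E ∧ x + h ∉ E} by ext x; simp [and_comm]]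
        refine hle.trans ?_
        gcongr
        exact (mem_ball_zero_iff.1 hh).le
    _ = _ := by simp [mul_comm]

/-- A weak isoperimetric inequality: it bounds the quotient `P(E) / |E|` below by `1 / (2 r)` if
`E` has at most half the measure of a ball of radius `r`. -/
theorem volume_le_mul_perimeter {E : Set (EuclideanSpace ℝ (Fin N))} (hm : MeasurableSet E)
    {r : ℝ} (hr : 0 < r)
    (hvol : 2 * volume E ≤ volume (Metric.ball (0 : EuclideanSpace ℝ (Fin N)) r)) :
    volume E ≤ 2 * ENNReal.ofReal r * perimeter E := by
  set b := volume (Metric.ball (0 : EuclideanSpace ℝ (Fin N)) r) with hb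
  have hb0 : b ≠ 0 := (Metric.measure_ball_pos volume _ hr).ne'
  have hbtop : b ≠ ∞ := measure_ball_lt_top.ne
  have hE : volume E ≠ ∞ := by
    refine ne_top_of_le_ne_top hbtop (le_trans ?_ hvol)
    exact le_mul_of_one_le_left (zero_le) (by norm_num)
  have h1 := lintegral_volume_ball_diff_le hm hE r
  have h2 : volume E * (b / 2) ≤ ∫⁻ x in E, volume (Metric.ball x r \ E) := by
    have : ∫⁻ _ in E, b / 2 = volume E * (b / 2) := by simp [mul_comm]
    rw [← this]
    refine setLIntegral_mono' hm fun x _ => ?_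
    refine le_trans ?_ le_measure_sdiff
    rw [Measure.addHaar_ball_center, ← hb]
    refine ENNReal.le_sub_of_add_le_right hE ?_
    calc b / 2 + volume E ≤ b / 2 + b / 2 := by
          gcongr
          rw [ENNReal.le_div_iff_mul_le (by simp) (by simp), mul_comm]
          exact hvol
      _ = b := ENNReal.add_halves b
  have h3 := h2.trans h1
  have h4 : b * volume E ≤ b * (2 * ENNReal.ofReal r * perimeter E) := by
    calc b * volume E = 2 * (volume E * (b / 2)) := by
          rw [mul_comm (volume E), ← mul_assoc, ENNReal.mul_div_cancel (by simp) (by simp)]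
      _ ≤ 2 * (b * (ENNReal.ofReal r * perimeter E)) := by gcongr
      _ = _ := by ring
  exact (ENNReal.mul_le_mul_iff_right hb0 hbtop).1 h4

end Translation

/-! ### Compactness of sets of bounded perimeter -/

section Compactness

variable {N : ℕ}

theorem measurable_volume_ball_inter {B : Set (EuclideanSpace ℝ (Fin N))} (hB : MeasurableSet B)
    (r : ℝ) : Measurable fun x : EuclideanSpace ℝ (Fin N) => volume (Metric.ball x r ∩ B) := by
  have hS : MeasurableSet {p : EuclideanSpace ℝ (Fin N) × EuclideanSpace ℝ (Fin N) |
      dist p.2 p.1 < r ∧ p.2 ∈ B} :=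
    (measurableSet_lt (measurable_snd.dist measurable_fst) measurable_const).inter
      (measurable_snd hB)
  exact measurable_measure_prodMk_left (ν := volume) hS

theorem lintegral_volume_ball_inter_comm {A B : Set (EuclideanSpace ℝ (Fin N))}
    (r : ℝ) :
    ∫⁻ x in A, volume (Metric.ball x r ∩ B) = ∫⁻ x in B, volume (Metric.ball x r ∩ A) := by
  have hS : MeasurableSet {p : EuclideanSpace ℝ (Fin N) × EuclideanSpace ℝ (Fin N) |
      dist p.2 p.1 < r} :=
    measurableSet_lt (measurable_snd.dist measurable_fst) measurable_const
  have h : ∀ D : Set (EuclideanSpace ℝ (Fin N)), ∀ x,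
      volume (Metric.ball x r ∩ D) = ∫⁻ y in D, (Metric.ball x r).indicator 1 y := by
    intro D x
    rw [lintegral_indicator_one Metric.isOpen_ball.measurableSet,
      Measure.restrict_apply Metric.isOpen_ball.measurableSet]
  simp only [h]
  have heq : (fun x y : EuclideanSpace ℝ (Fin N) =>
      (Metric.ball x r).indicator (1 : EuclideanSpace ℝ (Fin N) → ℝ≥0∞) y)
      = fun x y => {p : EuclideanSpace ℝ (Fin N) × EuclideanSpace ℝ (Fin N) |
        dist p.2 p.1 < r}.indicator (fun _ => (1 : ℝ≥0∞)) (x, y) := by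
    ext x y
    simp [indicator]
  have hsymm : ∀ x y : EuclideanSpace ℝ (Fin N),
      (Metric.ball x r).indicator (1 : EuclideanSpace ℝ (Fin N) → ℝ≥0∞) y
        = (Metric.ball y r).indicator 1 x := by
    intro x y
    simp [indicator, dist_comm]
  rw [lintegral_lintegral_swap]
  · simp only [fun y x => hsymm x y]
  · rw [heq]
    exact (measurable_const.indicator hS).aemeasurable

/-- Two sets whose measures in all balls of a small radius `r` are close are close in measure, up
to an error controlled by `r` and the perimeters. -/
theorem volume_diff_mul_le {E F : Set (EuclideanSpace ℝ (Fin N))} (hE : MeasurableSet E)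
    (hF : MeasurableSet F) (hEv : volume E ≠ ∞) (hFv : volume F ≠ ∞) {r : ℝ} {η : ℝ≥0∞}
    (h : ∀ x ∈ E, volume (Metric.ball x r ∩ E) ≤ volume (Metric.ball x r ∩ F) + η) :
    volume (E \ F) * volume (Metric.ball (0 : EuclideanSpace ℝ (Fin N)) r) ≤
      volume (Metric.ball (0 : EuclideanSpace ℝ (Fin N)) r) * (ENNReal.ofReal r * perimeter F)
      + η * volume E
      + volume (Metric.ball (0 : EuclideanSpace ℝ (Fin N)) r)
        * (ENNReal.ofReal r * perimeter E) := by
  set b := volume (Metric.ball (0 : EuclideanSpace ℝ (Fin N)) r) with hb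
  calc volume (E \ F) * b = ∫⁻ x in E \ F, b := by simp [mul_comm]
    _ ≤ ∫⁻ x in E \ F, (volume (Metric.ball x r ∩ F) + η + volume (Metric.ball x r ∩ Eᶜ)) := by
        refine setLIntegral_mono' (hE.diff hF) fun x hx => ?_
        rw [hb, ← Measure.addHaar_ball_center volume x, ← measure_inter_add_sdiff _ hE]
        exact add_le_add (h x hx.1) le_rfl
    _ = (∫⁻ x in E \ F, volume (Metric.ball x r ∩ F)) + η * volume (E \ F)
        + ∫⁻ x in E \ F, volume (Metric.ball x r ∩ Eᶜ) := by
        rw [lintegral_add_right _ (measurable_volume_ball_inter hE.compl r),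
          lintegral_add_right _ measurable_const]
        simp
    _ ≤ (∫⁻ x in Fᶜ, volume (Metric.ball x r ∩ F)) + η * volume E
        + ∫⁻ x in E, volume (Metric.ball x r ∩ Eᶜ) := by
        gcongr
        · exact fun x hx => hx.2
        · exact sdiff_subset
        · exact sdiff_subset
    _ ≤ _ := by
        rw [lintegral_volume_ball_inter_comm]
        gcongr
        · exact lintegral_volume_ball_diff_le hF hFv r
        · exact lintegral_volume_ball_diff_le hE hEv r

theorem volume_ball_inter_le {E : Set (EuclideanSpace ℝ (Fin N))} (hE : MeasurableSet E)
    (hEv : volume E ≠ ∞) (x y : EuclideanSpace ℝ (Fin N)) (r : ℝ) :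
    volume (Metric.ball x r ∩ E) ≤ volume (Metric.ball y r ∩ E)
      + ENNReal.ofReal (dist x y) * perimeter E := by
  have h1 : Metric.ball x r ∩ E ⊆ (fun z => z + (y - x)) ⁻¹' (Metric.ball y r ∩ E)
      ∪ {z | z ∈ E ∧ z + (y - x) ∉ E} := by
    rintro z ⟨hz, hzE⟩
    by_cases h : z + (y - x) ∈ E
    · refine Or.inl ⟨?_, h⟩
      rw [mem_ball_iff_norm] at hz ⊢
      rwa [show z + (y - x) - y = z - x by abel]
    · exact Or.inr ⟨hzE, h⟩
  refine (measure_mono h1).trans ((measure_union_le _ _).trans ?_)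
  rw [measure_preimage_add_right]
  gcongr
  rw [dist_comm, dist_eq_norm]
  exact volume_translate_diff_le hE hEv _

open scoped Classical in
/-- The characteristic function of a measurable set of finite measure, as an element of `L¹`
(and `0` for all other sets). -/
noncomputable def chi (E : Set (EuclideanSpace ℝ (Fin N))) :
    EuclideanSpace ℝ (Fin N) →₁[volume] ℝ :=
  if h : Integrable (E.indicator (1 : EuclideanSpace ℝ (Fin N) → ℝ)) volume then h.toL1 _ else 0

theorem coeFn_chi {E : Set (EuclideanSpace ℝ (Fin N))} (hE : NullMeasurableSet E volume)
    (hEv : volume E ≠ ∞) :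
    (chi E : EuclideanSpace ℝ (Fin N) → ℝ) =ᵐ[volume] E.indicator 1 := by
  have h : Integrable (E.indicator (1 : EuclideanSpace ℝ (Fin N) → ℝ)) volume :=
    IntegrableOn.integrable_indicator₀ (integrableOn_const hEv) hE
  rw [chi, dif_pos h]
  exact Integrable.coeFn_toL1 h

theorem chi_congr {E F : Set (EuclideanSpace ℝ (Fin N))} (hE : NullMeasurableSet E volume)
    (hEv : volume E ≠ ∞) (h : E =ᵐ[volume] F) : chi E = chi F := by
  refine Lp.ext ?_
  refine (coeFn_chi hE hEv).trans ?_
  refine (indicator_ae_eq_of_ae_eq_set h).trans (coeFn_chi (hE.congr h) ?_).symm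
  rwa [← measure_congr h]

theorem edist_chi {E F : Set (EuclideanSpace ℝ (Fin N))} (hE : MeasurableSet E)
    (hF : MeasurableSet F) (hEv : volume E ≠ ∞) (hFv : volume F ≠ ∞) :
    edist (chi E) (chi F) = volume (E \ F) + volume (F \ E) := by
  rw [L1.edist_def, ← lintegral_indicator_one (hE.diff hF), ← lintegral_indicator_one (hF.diff hE),
    ← lintegral_add_left (measurable_one.indicator (hE.diff hF))]
  refine lintegral_congr_ae ?_
  filter_upwards [coeFn_chi hE.nullMeasurableSet hEv, coeFn_chi hF.nullMeasurableSet hFv]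
    with x h1 h2
  rw [h1, h2]
  by_cases hxE : x ∈ E <;> by_cases hxF : x ∈ F <;> simp [hxE, hxF, edist_dist]

/-- Rellich compactness for characteristic functions: a set in a ball is determined up to a small
measure by its perimeter bound and by the approximate measures of its intersections with
finitely many small balls. -/
theorem totallyBounded_chi (R : ℝ) (C : NNReal) :
    TotallyBounded {f : EuclideanSpace ℝ (Fin N) →₁[volume] ℝ | ∃ E, MeasurableSet E ∧
      E ⊆ Metric.closedBall 0 R ∧ perimeter E ≤ C ∧ chi E = f} := by
  refine Metric.totallyBounded_of_finite_discretization fun ε hε => ?_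
  have hVfin : volume (Metric.closedBall (0 : EuclideanSpace ℝ (Fin N)) R) ≠ ∞ :=
    measure_closedBall_lt_top.ne
  set V := (volume (Metric.closedBall (0 : EuclideanSpace ℝ (Fin N)) R)).toReal with hV
  have hV0 : 0 ≤ V := ENNReal.toReal_nonneg
  have hC0 : (0 : ℝ) ≤ C := C.2
  -- the radius of the small balls
  obtain ⟨r, hr, hrC⟩ : ∃ r : ℝ, 0 < r ∧ r * C ≤ ε / 16 := by
    refine ⟨ε / (16 * (C + 1)), by positivity, ?_⟩
    rw [div_mul_eq_mul_div, div_le_div_iff₀ (by positivity) (by norm_num)]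
    nlinarith
  set b := volume (Metric.ball (0 : EuclideanSpace ℝ (Fin N)) r) with hb
  have hb0 : b ≠ 0 := (Metric.measure_ball_pos volume _ hr).ne'
  have hbtop : b ≠ ∞ := measure_ball_lt_top.ne
  have hbpos : 0 < b.toReal := ENNReal.toReal_pos hb0 hbtop
  -- the mesh of the net of their centres, and the accuracy of the measures
  obtain ⟨τ, hτ, hτV⟩ : ∃ τ : ℝ, 0 < τ ∧ (2 * C + 1) * τ * V ≤ b.toReal * (ε / 8) := by
    refine ⟨b.toReal * (ε / 8) / ((2 * C + 1) * (V + 1)), by positivity, ?_⟩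
    rw [mul_div_assoc', div_mul_eq_mul_div, div_le_iff₀ (by positivity)]
    have : 0 < (2 * C + 1) * (b.toReal * (ε / 8)) := by positivity
    nlinarith
  obtain ⟨t, -, htfin, ht⟩ :=
    (isCompact_closedBall (0 : EuclideanSpace ℝ (Fin N)) R).finite_cover_balls hτ
  have hvol : ∀ E : Set (EuclideanSpace ℝ (Fin N)), E ⊆ Metric.closedBall 0 R → volume E ≠ ∞ :=
    fun E hE => ne_top_of_le_ne_top hVfin (measure_mono hE)
  have hball : ∀ (y : EuclideanSpace ℝ (Fin N)) (E : Set (EuclideanSpace ℝ (Fin N))),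
      volume (Metric.ball y r ∩ E) ≤ b := fun y E =>
    (measure_mono inter_subset_left).trans (Measure.addHaar_ball_center volume y r).le
  have : Fintype t := htfin.fintype
  classical
  let S := {f : EuclideanSpace ℝ (Fin N) →₁[volume] ℝ | ∃ E, MeasurableSet E ∧
      E ⊆ Metric.closedBall 0 R ∧ perimeter E ≤ C ∧ chi E = f}
  let G : S → Set (EuclideanSpace ℝ (Fin N)) := fun f => f.2.choose
  have hG : ∀ f : S, MeasurableSet (G f) ∧ G f ⊆ Metric.closedBall 0 R ∧ perimeter (G f) ≤ C ∧
    chi (G f) = f.1 := fun f => f.2.choose_spec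
  refine ⟨t → Fin (⌊b.toReal / τ⌋₊ + 1), inferInstance, fun f y =>
    ⟨⌊(volume (Metric.ball y.1 r ∩ G f)).toReal / τ⌋₊, Nat.lt_succ_of_le (Nat.floor_mono ?_)⟩, ?_⟩
  · gcongr
    exact hball _ _
  intro f g hfg
  obtain ⟨hE, hER, hEC, hEf⟩ := hG f
  obtain ⟨hF, hFR, hFC, hFg⟩ := hG g
  rw [← hEf, ← hFg]
  -- the estimate is symmetric in the two sets
  have key : ∀ E F : Set (EuclideanSpace ℝ (Fin N)), MeasurableSet E → MeasurableSet F →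
      E ⊆ Metric.closedBall 0 R → F ⊆ Metric.closedBall 0 R → perimeter E ≤ C → perimeter F ≤ C →
      (∀ y : t, ⌊(volume (Metric.ball y.1 r ∩ E)).toReal / τ⌋₊
        = ⌊(volume (Metric.ball y.1 r ∩ F)).toReal / τ⌋₊) →
      volume (E \ F) ≤ ENNReal.ofReal (ε / 4) := by
    intro E F hE hF hER hFR hEC hFC hfl
    have hcomp : ∀ x ∈ E, volume (Metric.ball x r ∩ E) ≤
        volume (Metric.ball x r ∩ F) + ENNReal.ofReal ((2 * C + 1) * τ) := by
      intro x hx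
      obtain ⟨y, hy, hxy⟩ := mem_iUnion₂.1 (ht (hER hx))
      have hd : ENNReal.ofReal (dist x y) ≤ ENNReal.ofReal τ :=
        ENNReal.ofReal_le_ofReal (Metric.mem_ball.1 hxy).le
      have hτC : ENNReal.ofReal τ * (C : ℝ≥0∞) = ENNReal.ofReal (τ * C) := by
        rw [ENNReal.ofReal_mul hτ.le, ENNReal.ofReal_coe_nnreal]
      have h1 : volume (Metric.ball x r ∩ E) ≤
          volume (Metric.ball y r ∩ E) + ENNReal.ofReal (τ * C) := by
        refine (volume_ball_inter_le hE (hvol E hER) x y r).trans ?_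
        rw [← hτC]
        gcongr
      have h2 : volume (Metric.ball y r ∩ F) ≤
          volume (Metric.ball x r ∩ F) + ENNReal.ofReal (τ * C) := by
        refine (volume_ball_inter_le hF (hvol F hFR) y x r).trans ?_
        rw [← hτC, dist_comm y x]
        gcongr
      have h3 : volume (Metric.ball y r ∩ E) ≤
          volume (Metric.ball y r ∩ F) + ENNReal.ofReal τ := by
        have hEt : volume (Metric.ball y r ∩ E) ≠ ∞ := ne_top_of_le_ne_top hbtop (hball _ _)
        have hFt : volume (Metric.ball y r ∩ F) ≠ ∞ := ne_top_of_le_ne_top hbtop (hball _ _)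
        rw [← ENNReal.ofReal_toReal hEt, ← ENNReal.ofReal_toReal hFt,
          ← ENNReal.ofReal_add ENNReal.toReal_nonneg hτ.le]
        refine ENNReal.ofReal_le_ofReal ?_
        have h4 := Nat.lt_floor_add_one ((volume (Metric.ball y r ∩ E)).toReal / τ)
        rw [hfl ⟨y, hy⟩] at h4
        have h5 := Nat.floor_le (a := (volume (Metric.ball y r ∩ F)).toReal / τ) (by positivity)
        have h6 := h4.le.trans (add_le_add_left h5 1)
        rw [div_add_one hτ.ne', div_le_div_iff_of_pos_right hτ] at h6
        exact h6
      calc volume (Metric.ball x r ∩ E)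
          ≤ volume (Metric.ball x r ∩ F) + ENNReal.ofReal (τ * C) + ENNReal.ofReal τ
            + ENNReal.ofReal (τ * C) := h1.trans (by gcongr; exact h3.trans (by gcongr))
        _ = volume (Metric.ball x r ∩ F) + ENNReal.ofReal ((2 * C + 1) * τ) := by
          rw [add_assoc, add_assoc, ← ENNReal.ofReal_add hτ.le (by positivity),
            ← ENNReal.ofReal_add (by positivity) (by positivity)]
          congr 2
          ring
    have h1 := volume_diff_mul_le hE hF (hvol E hER) (hvol F hFR) hcomp
    have hrC' : ∀ P : ℝ≥0∞, P ≤ C → ENNReal.ofReal r * P ≤ ENNReal.ofReal (ε / 16) := by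
      intro P hP
      calc ENNReal.ofReal r * P ≤ ENNReal.ofReal r * C := by gcongr
        _ = ENNReal.ofReal (r * C) := by
          rw [ENNReal.ofReal_mul hr.le, ENNReal.ofReal_coe_nnreal]
        _ ≤ _ := ENNReal.ofReal_le_ofReal hrC
    have hη : ENNReal.ofReal ((2 * C + 1) * τ) * volume E ≤ b * ENNReal.ofReal (ε / 8) := by
      calc ENNReal.ofReal ((2 * C + 1) * τ) * volume E
          ≤ ENNReal.ofReal ((2 * C + 1) * τ) * ENNReal.ofReal V := by
            gcongr
            rw [hV, ENNReal.ofReal_toReal hVfin]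
            exact measure_mono hER
        _ = ENNReal.ofReal ((2 * C + 1) * τ * V) := (ENNReal.ofReal_mul (by positivity)).symm
        _ ≤ ENNReal.ofReal (b.toReal * (ε / 8)) := ENNReal.ofReal_le_ofReal hτV
        _ = _ := by rw [ENNReal.ofReal_mul hbpos.le, ENNReal.ofReal_toReal hbtop]
    have h2 : b * volume (E \ F) ≤ b * ENNReal.ofReal (ε / 4) := by
      calc b * volume (E \ F) = volume (E \ F) * b := mul_comm _ _
        _ ≤ b * ENNReal.ofReal (ε / 16) + b * ENNReal.ofReal (ε / 8)
            + b * ENNReal.ofReal (ε / 16) := by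
            refine h1.trans ?_
            gcongr
            · exact hrC' _ hFC
            · exact hrC' _ hEC
        _ = b * ENNReal.ofReal (ε / 4) := by
            rw [← mul_add, ← mul_add, ← ENNReal.ofReal_add (by positivity) (by positivity),
              ← ENNReal.ofReal_add (by positivity) (by positivity)]
            congr 2
            ring
    exact (ENNReal.mul_le_mul_iff_right hb0 hbtop).1 h2
  have hfl : ∀ y : t, ⌊(volume (Metric.ball y.1 r ∩ G f)).toReal / τ⌋₊
        = ⌊(volume (Metric.ball y.1 r ∩ G g)).toReal / τ⌋₊ := fun y =>
    Fin.mk.inj_iff.1 (congrFun hfg y)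
  have hedist : edist (chi (G f)) (chi (G g)) ≤ ENNReal.ofReal (ε / 2) := by
    rw [edist_chi hE hF (hvol _ hER) (hvol _ hFR)]
    refine (add_le_add (key _ _ hE hF hER hFR hEC hFC hfl)
      (key _ _ hF hE hFR hER hFC hEC fun y => (hfl y).symm)).trans (le_of_eq ?_)
    rw [← ENNReal.ofReal_add (by positivity) (by positivity)]
    congr 1
    ring
  rw [edist_dist, ENNReal.ofReal_le_ofReal_iff (by positivity)] at hedist
  linarith

end Compactness

/-! ### The perimeter quotient on `L¹` and the space of competitors -/

section Competitors

variable {N : ℕ}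

theorem continuous_integral_mul {g : EuclideanSpace ℝ (Fin N) → ℝ} (hg : Continuous g)
    (hc : HasCompactSupport g) :
    Continuous fun f : EuclideanSpace ℝ (Fin N) →₁[volume] ℝ => ∫ x, f x * g x := by
  obtain ⟨M, hM⟩ := hc.exists_bound_of_continuous hg
  have hM0 : 0 ≤ M := (norm_nonneg _).trans (hM 0)
  have hint : ∀ f : EuclideanSpace ℝ (Fin N) →₁[volume] ℝ,
      Integrable (fun x => f x * g x) volume := fun f =>
    (L1.integrable_coeFn f).mul_bdd (c := M) hg.aestronglyMeasurable
      (Filter.Eventually.of_forall hM)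
  refine (LipschitzWith.of_dist_le_mul (K := M.toNNReal) fun f f' => ?_).continuous
  rw [dist_eq_norm, dist_eq_norm, ← integral_sub (hint f) (hint f'), L1.norm_eq_integral_norm,
    Real.coe_toNNReal M hM0, ← integral_const_mul]
  refine (norm_integral_le_integral_norm _).trans (integral_mono_ae ?_ ?_ ?_)
  · exact ((hint f).sub (hint f')).norm
  · exact (L1.integrable_coeFn (f - f')).norm.const_mul M
  · filter_upwards [Lp.coeFn_sub f f'] with x hx
    simp only [hx, Pi.sub_apply]
    rw [← sub_mul, norm_mul, mul_comm]
    gcongr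
    exact hM x

/-- The quotient of the total variation and the integral of an `L¹` function; for a characteristic
function it is the quotient of perimeter and measure. -/
noncomputable def quotient (f : EuclideanSpace ℝ (Fin N) →₁[volume] ℝ) : ℝ≥0∞ :=
  ⨆ (φ : EuclideanSpace ℝ (Fin N) → EuclideanSpace ℝ (Fin N)) (_ : ContDiff ℝ 1 φ)
    (_ : HasCompactSupport φ) (_ : ∀ x, ‖φ x‖ ≤ 1),
    ENNReal.ofReal ((∫ x, f x * divergence φ x) / ∫ x, f x)

theorem integral_chi_mul {E : Set (EuclideanSpace ℝ (Fin N))} (hE : NullMeasurableSet E volume)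
    (hEv : volume E ≠ ∞) (g : EuclideanSpace ℝ (Fin N) → ℝ) :
    ∫ x, chi E x * g x = ∫ x in E, g x := by
  rw [← integral_indicator₀ hE]
  refine integral_congr_ae ?_
  filter_upwards [coeFn_chi hE hEv] with x hx
  rw [hx]
  by_cases h : x ∈ E <;> simp [h]

theorem integral_chi {E : Set (EuclideanSpace ℝ (Fin N))} (hE : NullMeasurableSet E volume)
    (hEv : volume E ≠ ∞) : ∫ x, chi E x = volume.real E := by
  simpa using integral_chi_mul hE hEv fun _ => 1

theorem quotient_chi {E : Set (EuclideanSpace ℝ (Fin N))} (hE : NullMeasurableSet E volume)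
    (hEv : volume E ≠ ∞) (hE0 : 0 < volume E) : quotient (chi E) = ratio E := by
  have hpos : 0 < volume.real E := ENNReal.toReal_pos hE0.ne' hEv
  simp only [quotient, ratio, perimeter, ENNReal.iSup_div, integral_chi_mul hE hEv,
    integral_chi hE hEv, ENNReal.ofReal_div_of_pos hpos, ofReal_measureReal hEv]

theorem lowerSemicontinuousOn_quotient {δ : ℝ} (hδ : 0 < δ) :
    LowerSemicontinuousOn (quotient (N := N)) {f | δ ≤ ∫ x, f x} := by
  unfold quotient
  refine lowerSemicontinuousOn_iSup fun φ => lowerSemicontinuousOn_iSup fun hφ =>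
    lowerSemicontinuousOn_iSup fun hc => lowerSemicontinuousOn_iSup fun _ => ?_
  refine ContinuousOn.lowerSemicontinuousOn ?_
  refine ENNReal.continuous_ofReal.comp_continuousOn (ContinuousOn.div ?_ ?_ ?_)
  · exact (continuous_integral_mul (continuous_divergence hφ)
      (hasCompactSupport_divergence hc)).continuousOn
  · exact continuous_integral.continuousOn
  · exact fun f hf => (hδ.trans_le hf).ne'

/-- The `k`-tuples of (classes of) disjoint subsets of `Ω` with measures at least `δ` and
quotients at most `C`, as a subset of a power of `L¹`: an integrable `f` is a characteristic
function of a subset of `Ω` if and only if `min(f, 1_Ω - f) = 0`. -/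
def competitors {k : ℕ} (Ω : Set (EuclideanSpace ℝ (Fin N))) (δ : ℝ) (C : NNReal) :
    Set (Fin k → (EuclideanSpace ℝ (Fin N) →₁[volume] ℝ)) :=
  {f | (∀ i, f i ⊓ (chi Ω - f i) = 0) ∧ (∀ i j, i ≠ j → f i ⊓ f j = 0) ∧
    ∀ i, δ ≤ ∫ x, f i x ∧ quotient (f i) ≤ C}

theorem isClosed_competitors {k : ℕ} (Ω : Set (EuclideanSpace ℝ (Fin N))) {δ : ℝ} (hδ : 0 < δ)
    (C : NNReal) : IsClosed (competitors (k := k) Ω δ C) := by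
  have h1 : IsClosed {f : Fin k → (EuclideanSpace ℝ (Fin N) →₁[volume] ℝ) |
      ∀ i, f i ⊓ (chi Ω - f i) = 0} := by
    simp only [ofPred_forall]
    refine isClosed_iInter fun i => isClosed_eq ?_ continuous_const
    exact (continuous_apply i).inf (continuous_const.sub (continuous_apply i))
  have h2 : IsClosed {f : Fin k → (EuclideanSpace ℝ (Fin N) →₁[volume] ℝ) |
      ∀ i j, i ≠ j → f i ⊓ f j = 0} := by
    simp only [ofPred_forall]
    exact isClosed_iInter fun i => isClosed_iInter fun j => isClosed_iInter fun _ =>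
      isClosed_eq ((continuous_apply i).inf (continuous_apply j)) continuous_const
  have h3 : IsClosed {f : Fin k → (EuclideanSpace ℝ (Fin N) →₁[volume] ℝ) |
      ∀ i, δ ≤ ∫ x, f i x ∧ quotient (f i) ≤ C} := by
    simp only [ofPred_forall]
    refine isClosed_iInter fun i => ?_
    have hs : IsClosed {f : EuclideanSpace ℝ (Fin N) →₁[volume] ℝ | δ ≤ ∫ x, f x} :=
      isClosed_le continuous_const continuous_integral
    obtain ⟨v, hv, hv'⟩ := lowerSemicontinuousOn_iff_preimage_Iic.1
      (lowerSemicontinuousOn_quotient (N := N) hδ) (C : ℝ≥0∞)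
    have hsv : IsClosed ({f : EuclideanSpace ℝ (Fin N) →₁[volume] ℝ | δ ≤ ∫ x, f x}
        ∩ quotient ⁻¹' Iic (C : ℝ≥0∞)) := by
      rw [hv']
      exact hs.inter hv
    have hc : Continuous fun f : Fin k → (EuclideanSpace ℝ (Fin N) →₁[volume] ℝ) => f i :=
      continuous_apply i
    exact hsv.preimage hc
  exact h1.inter (h2.inter h3)

theorem exists_eq_chi {Ω : Set (EuclideanSpace ℝ (Fin N))} (hΩ : NullMeasurableSet Ω volume)
    (hΩv : volume Ω ≠ ∞) {f : EuclideanSpace ℝ (Fin N) →₁[volume] ℝ}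
    (hf : f ⊓ (chi Ω - f) = 0) :
    ∃ S, NullMeasurableSet S volume ∧ S ⊆ Ω ∧ chi S = f := by
  have hS : MeasurableSet {x | f x = 1} :=
    (Lp.stronglyMeasurable f).measurable (measurableSet_singleton 1)
  have hSn : NullMeasurableSet ({x | f x = 1} ∩ Ω) volume := hS.nullMeasurableSet.inter hΩ
  refine ⟨{x | f x = 1} ∩ Ω, hSn, inter_subset_right, Lp.ext ?_⟩
  have h0 : (f ⊓ (chi Ω - f) : EuclideanSpace ℝ (Fin N) →₁[volume] ℝ) =ᵐ[volume]
      (0 : EuclideanSpace ℝ (Fin N) → ℝ) := by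
    rw [hf]
    exact Lp.coeFn_zero _ _ _
  filter_upwards [coeFn_chi hSn (ne_top_of_le_ne_top hΩv (measure_mono inter_subset_right)),
    Lp.coeFn_inf f (chi Ω - f), Lp.coeFn_sub (chi Ω) f, coeFn_chi hΩ hΩv, h0] with x h1 h2 h3 h4 h5
  rw [h1]
  rw [h2, Pi.inf_apply, h3, Pi.sub_apply, h4, Pi.zero_apply] at h5
  by_cases hx : x ∈ Ω
  · simp only [indicator, hx, if_true, Pi.one_apply, mem_inter_iff, mem_ofPred_eq, and_true] at h5 ⊢
    rcases min_choice (f x) (1 - f x) with h | h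
    · rw [h] at h5
      simp [h5]
    · rw [h] at h5
      have : f x = 1 := by linarith
      simp [this]
  · simp only [indicator, hx, if_false, mem_inter_iff, and_false, zero_sub] at h5 ⊢
    rcases min_choice (f x) (-f x) with h | h
    · rw [h] at h5
      exact h5.symm
    · rw [h] at h5
      linarith

theorem chi_inf_chi_eq_zero_iff {E F : Set (EuclideanSpace ℝ (Fin N))}
    (hE : NullMeasurableSet E volume) (hF : NullMeasurableSet F volume) (hEv : volume E ≠ ∞)
    (hFv : volume F ≠ ∞) : chi E ⊓ chi F = 0 ↔ volume (E ∩ F) = 0 := by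
  rw [Lp.ext_iff, ← ae_eq_empty, Filter.eventuallyEq_set]
  refine Filter.eventually_congr ?_
  filter_upwards [coeFn_chi hE hEv, coeFn_chi hF hFv, Lp.coeFn_inf (chi E) (chi F),
    Lp.coeFn_zero ℝ 1 (volume : Measure (EuclideanSpace ℝ (Fin N)))] with x h1 h2 h3 h4
  rw [h3, h4, Pi.inf_apply, h1, h2]
  by_cases hxE : x ∈ E <;> by_cases hxF : x ∈ F <;> simp [hxE, hxF]

theorem exists_isAdmissible_of_mem_competitors {k : ℕ} {Ω : Set (EuclideanSpace ℝ (Fin N))}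
    (hΩ : NullMeasurableSet Ω volume) (hΩv : volume Ω ≠ ∞) {δ : ℝ} (hδ : 0 < δ) {C : NNReal}
    {f : Fin k → (EuclideanSpace ℝ (Fin N) →₁[volume] ℝ)} (hf : f ∈ competitors Ω δ C) :
    ∃ E : Fin k → Set (EuclideanSpace ℝ (Fin N)), IsAdmissible Ω E ∧ ∀ i, chi (E i) = f i := by
  obtain ⟨h1, h2, h3⟩ := hf
  choose S hSm hSΩ hSf using fun i => exists_eq_chi hΩ hΩv (h1 i)
  have hSv : ∀ i, volume (S i) ≠ ∞ := fun i => ne_top_of_le_ne_top hΩv (measure_mono (hSΩ i))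
  have hnull : ∀ i j, i ≠ j → volume (S i ∩ S j) = 0 := by
    intro i j hij
    rw [← chi_inf_chi_eq_zero_iff (hSm i) (hSm j) (hSv i) (hSv j), hSf, hSf]
    exact h2 i j hij
  -- removing null sets makes the sets disjoint
  have hae : ∀ i, (S i \ ⋃ j ∈ {j | j ≠ i}, S j : Set (EuclideanSpace ℝ (Fin N)))
      =ᵐ[volume] S i := by
    intro i
    refine sdiff_ae_eq_self.2 ?_
    rw [inter_iUnion₂]
    exact (measure_biUnion_null_iff (to_countable _)).2 fun j hj => hnull i j (Ne.symm hj)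
  refine ⟨fun i => S i \ ⋃ j ∈ {j | j ≠ i}, S j, ⟨fun i => sdiff_subset.trans (hSΩ i),
    fun i => (hSm i).congr (hae i).symm, fun i => ?_, fun i j hij => ?_⟩, fun i => ?_⟩
  · rw [measure_congr (hae i)]
    have := (h3 i).1
    rw [← hSf i, integral_chi (hSm i) (hSv i)] at this
    exact (ENNReal.toReal_pos_iff.1 (hδ.trans_le this)).1
  · refine Set.disjoint_left.2 ?_
    exact fun x hx hx' => hx'.2 (mem_biUnion (show i ∈ {i | i ≠ j} from hij) hx.1)
  · rw [← hSf i]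
    exact chi_congr ((hSm i).congr (hae i).symm) (by rw [measure_congr (hae i)]; exact hSv i)
      (hae i)

/-- The perimeters of the competitors are bounded by `C |Ω|`, so they lie in a power of a totally
bounded set. -/
theorem isCompact_competitors {k : ℕ} {Ω : Set (EuclideanSpace ℝ (Fin N))}
    (hΩ : NullMeasurableSet Ω volume) (hb : Bornology.IsBounded Ω) {δ : ℝ} (hδ : 0 < δ)
    (C : NNReal) : IsCompact (competitors (k := k) Ω δ C) := by
  have hΩv : volume Ω ≠ ∞ := hb.measure_lt_top.ne
  obtain ⟨R, hR⟩ := hb.subset_closedBall (0 : EuclideanSpace ℝ (Fin N))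
  have hTB := totallyBounded_chi (N := N) R (C * (volume Ω).toNNReal)
  have hcomp := isCompact_univ_pi (fun _ : Fin k =>
    hTB.closure.isCompact_of_isClosed isClosed_closure)
  refine hcomp.of_isClosed_subset (isClosed_competitors Ω hδ C) fun f hf i _ => subset_closure ?_
  obtain ⟨E, hE, hEf⟩ := exists_isAdmissible_of_mem_competitors hΩ hΩv hδ hf
  have hEv : volume (E i) ≠ ∞ := ne_top_of_le_ne_top hΩv (measure_mono (hE.subset i))
  obtain ⟨T, hTE, hTm, hTae⟩ := (hE.measurable i).exists_measurable_subset_ae_eq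
  refine ⟨T, hTm, hTE.trans ((hE.subset i).trans hR), ?_, ?_⟩
  · have h1 := (hf.2.2 i).2
    rw [← hEf i, quotient_chi (hE.measurable i) hEv (hE.pos i), ratio,
      ENNReal.div_le_iff (hE.pos i).ne' hEv] at h1
    rw [perimeter_congr hTae, ENNReal.coe_mul, ENNReal.coe_toNNReal hΩv]
    refine h1.trans ?_
    gcongr
    exact hE.subset i
  · rw [← hEf i]
    exact chi_congr hTm.nullMeasurableSet (by rw [measure_congr hTae]; exact hEv) hTae

/-- By the isoperimetric inequality, sets of small quotient are not too small. -/
theorem exists_le_volume_of_ratio_le (C : NNReal) :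
    ∃ δ : ℝ, 0 < δ ∧ ∀ E : Set (EuclideanSpace ℝ (Fin N)), NullMeasurableSet E volume →
      volume E ≠ ∞ → 0 < volume E → ratio E ≤ C → δ ≤ volume.real E := by
  -- with this radius, `|E| ≤ 2 r P(E) ≤ 2 r C |E| < |E|` if `E` is smaller than half a ball
  set r : ℝ := 1 / (4 * (C + 1)) with hr
  have hC0 : (0 : ℝ) ≤ C := C.2
  have hr0 : 0 < r := by positivity
  set b := volume (Metric.ball (0 : EuclideanSpace ℝ (Fin N)) r) with hb
  have hb0 : b ≠ 0 := (Metric.measure_ball_pos volume _ hr0).ne'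
  have hbtop : b ≠ ∞ := measure_ball_lt_top.ne
  refine ⟨b.toReal / 2, half_pos (ENNReal.toReal_pos hb0 hbtop), fun E hE hEv hE0 hrat => ?_⟩
  by_contra hcon
  push Not at hcon
  obtain ⟨T, hTE, hTm, hTae⟩ := hE.exists_measurable_subset_ae_eq
  have hsmall : 2 * volume T ≤ b := by
    rw [measure_congr hTae, ← ENNReal.toReal_le_toReal (by finiteness) hbtop, ENNReal.toReal_mul]
    change 2 * volume.real E ≤ _
    linarith
  have h1 := volume_le_mul_perimeter hTm hr0 hsmall
  rw [measure_congr hTae, perimeter_congr hTae] at h1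
  rw [ratio, ENNReal.div_le_iff hE0.ne' hEv] at hrat
  have h2 : volume E ≤ ENNReal.ofReal (2 * r * C) * volume E := by
    calc volume E ≤ 2 * ENNReal.ofReal r * (C * volume E) := h1.trans (by gcongr)
      _ = ENNReal.ofReal (2 * r * C) * volume E := by
        rw [ENNReal.ofReal_mul (by positivity), ENNReal.ofReal_mul (by norm_num),
          ENNReal.ofReal_coe_nnreal, ENNReal.ofReal_ofNat]
        ring
  have h3 : 2 * r * C < 1 := by
    rw [hr, mul_one_div, div_mul_eq_mul_div, div_lt_one (by positivity)]
    linarith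
  have h4 : ENNReal.ofReal (2 * r * C) * volume E < 1 * volume E :=
    (ENNReal.mul_lt_mul_iff_left hE0.ne' hEv).2 (by
      rw [← ENNReal.ofReal_one]
      exact (ENNReal.ofReal_lt_ofReal_iff one_pos).2 h3)
  rw [one_mul] at h4
  exact absurd h2 (not_le.2 h4)

theorem IsAdmissible.chi_mem_competitors {k : ℕ} {Ω : Set (EuclideanSpace ℝ (Fin N))}
    (hΩ : NullMeasurableSet Ω volume) (hΩv : volume Ω ≠ ∞) {δ : ℝ} {C : NNReal}
    {E : Fin k → Set (EuclideanSpace ℝ (Fin N))} (hE : IsAdmissible Ω E)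
    (hδ : ∀ i, δ ≤ volume.real (E i)) (hC : ∀ i, ratio (E i) ≤ C) :
    (fun i => chi (E i)) ∈ competitors Ω δ C := by
  have hEv : ∀ i, volume (E i) ≠ ∞ := fun i =>
    ne_top_of_le_ne_top hΩv (measure_mono (hE.subset i))
  refine ⟨fun i => ?_, fun i j hij => ?_, fun i => ⟨?_, ?_⟩⟩
  · refine Lp.ext ?_
    filter_upwards [coeFn_chi (hE.measurable i) (hEv i),
      Lp.coeFn_inf (chi (E i)) (chi Ω - chi (E i)), Lp.coeFn_sub (chi Ω) (chi (E i)),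
      coeFn_chi hΩ hΩv,
      Lp.coeFn_zero ℝ 1 (volume : Measure (EuclideanSpace ℝ (Fin N)))] with x h1 h2 h3 h4 h5
    rw [h2, h5, Pi.inf_apply, h3, Pi.sub_apply, h4, h1]
    by_cases hx : x ∈ E i
    · simp [hx, hE.subset i hx]
    · by_cases hx' : x ∈ Ω <;> simp [hx, hx']
  · refine (chi_inf_chi_eq_zero_iff (hE.measurable i) (hE.measurable j) (hEv i) (hEv j)).2 ?_
    rw [(hE.disjoint hij).inter_eq, measure_empty]
  · rw [integral_chi (hE.measurable i) (hEv i)]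
    exact hδ i
  · rw [quotient_chi (hE.measurable i) (hEv i) (hE.pos i)]
    exact hC i

end Competitors

/-! ### Cutting sets by hyperplanes -/

section Cutting

variable {N : ℕ}

theorem deriv_smoothTransition_eq_zero {s : ℝ} (hs : s ∉ Icc (0 : ℝ) 1) :
    deriv Real.smoothTransition s = 0 := by
  rw [mem_Icc, not_and_or, not_le, not_le] at hs
  rcases hs with hs | hs
  · have : Real.smoothTransition =ᶠ[nhds s] fun _ => 0 := by
      filter_upwards [Iio_mem_nhds hs] with y hy
      exact Real.smoothTransition.zero_of_nonpos (le_of_lt hy)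
    rw [this.deriv_eq, deriv_const]
  · have : Real.smoothTransition =ᶠ[nhds s] fun _ => 1 := by
      filter_upwards [Ioi_mem_nhds hs] with y hy
      exact Real.smoothTransition.one_of_one_le (le_of_lt hy)
    rw [this.deriv_eq, deriv_const]

theorem exists_bound_deriv_smoothTransition :
    ∃ M : ℝ, ∀ s, |deriv Real.smoothTransition s| ≤ M := by
  have hcont : Continuous (deriv Real.smoothTransition) :=
    (Real.smoothTransition.contDiff (n := 1)).continuous_deriv le_rfl
  have hc : HasCompactSupport (deriv Real.smoothTransition) :=
    HasCompactSupport.intro (isCompact_Icc (a := (0 : ℝ)) (b := 1)) fun s hs =>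
      deriv_smoothTransition_eq_zero hs
  obtain ⟨M, hM⟩ := hc.exists_bound_of_continuous hcont
  exact ⟨M, hM⟩

/-- A smooth approximation of the characteristic function of the half-space `{ℓ < t}`: it descends
from `1` to `0` in the strip `{t - 1 / (n + 1) ≤ ℓ ≤ t}`. -/
noncomputable def cutoff (ℓ : EuclideanSpace ℝ (Fin N) →L[ℝ] ℝ) (t : ℝ) (n : ℕ)
    (x : EuclideanSpace ℝ (Fin N)) : ℝ :=
  Real.smoothTransition ((n + 1) * (t - ℓ x))

theorem contDiff_cutoff (ℓ : EuclideanSpace ℝ (Fin N) →L[ℝ] ℝ) (t : ℝ) (n : ℕ) :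
    ContDiff ℝ 1 (cutoff ℓ t n) :=
  Real.smoothTransition.contDiff.comp (contDiff_const.mul (contDiff_const.sub ℓ.contDiff))

theorem norm_cutoff_le (ℓ : EuclideanSpace ℝ (Fin N) →L[ℝ] ℝ) (t : ℝ) (n : ℕ)
    (x : EuclideanSpace ℝ (Fin N)) : ‖cutoff ℓ t n x‖ ≤ 1 := by
  rw [cutoff, Real.norm_of_nonneg (Real.smoothTransition.nonneg _)]
  exact Real.smoothTransition.le_one _

theorem tendsto_cutoff (ℓ : EuclideanSpace ℝ (Fin N) →L[ℝ] ℝ) (t : ℝ)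
    (x : EuclideanSpace ℝ (Fin N)) :
    Filter.Tendsto (fun n => cutoff ℓ t n x) Filter.atTop
      (nhds ({x | ℓ x < t}.indicator (fun _ => 1) x)) := by
  by_cases hx : ℓ x < t
  · rw [indicator_of_mem (show x ∈ {x | ℓ x < t} from hx)]
    refine tendsto_const_nhds.congr' ?_
    obtain ⟨n₀, hn₀⟩ := exists_nat_ge (1 / (t - ℓ x))
    filter_upwards [Filter.eventually_ge_atTop n₀] with n hn
    have h1 : (1 : ℝ) ≤ (n + 1) * (t - ℓ x) := by
      rw [← div_le_iff₀ (sub_pos.2 hx)]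
      have : (n₀ : ℝ) ≤ n := by exact_mod_cast hn
      linarith
    rw [cutoff, Real.smoothTransition.one_of_one_le h1]
  · rw [indicator_of_notMem (show x ∉ {x | ℓ x < t} from hx)]
    refine tendsto_const_nhds.congr fun n => ?_
    have h1 : ((n : ℝ) + 1) * (t - ℓ x) ≤ 0 :=
      mul_nonpos_of_nonneg_of_nonpos (by positivity) (by linarith)
    rw [cutoff, Real.smoothTransition.zero_of_nonpos h1]

theorem fderiv_cutoff (ℓ : EuclideanSpace ℝ (Fin N) →L[ℝ] ℝ) (t : ℝ) (n : ℕ)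
    (x v : EuclideanSpace ℝ (Fin N)) : fderiv ℝ (cutoff ℓ t n) x v
      = deriv Real.smoothTransition ((n + 1) * (t - ℓ x)) * ((n + 1) * -(ℓ v)) := by
  have h1 : HasFDerivAt (fun x => ((n : ℝ) + 1) * (t - ℓ x)) (((n : ℝ) + 1) • -ℓ) x :=
    (ℓ.hasFDerivAt.const_sub t).const_mul _
  have h2 : HasDerivAt Real.smoothTransition
      (deriv Real.smoothTransition ((n + 1) * (t - ℓ x))) ((n + 1) * (t - ℓ x)) :=
    ((Real.smoothTransition.contDiff (n := 1)).differentiable one_ne_zero _).hasDerivAt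
  have h3 : HasFDerivAt (cutoff ℓ t n) _ x := h2.comp_hasFDerivAt x h1
  rw [h3.fderiv]
  simp

theorem neg_fderiv_cutoff_le (ℓ : EuclideanSpace ℝ (Fin N) →L[ℝ] ℝ) (t : ℝ) (n : ℕ) {M : ℝ}
    (hM : ∀ s, |deriv Real.smoothTransition s| ≤ M) (x : EuclideanSpace ℝ (Fin N))
    {v : EuclideanSpace ℝ (Fin N)} (hv : ‖v‖ ≤ 1) :
    -fderiv ℝ (cutoff ℓ t n) x v ≤
      {x | t - 1 / (n + 1) ≤ ℓ x ∧ ℓ x ≤ t}.indicator (fun _ => M * (n + 1) * ‖ℓ‖) x := by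
  have hn : (0 : ℝ) < n + 1 := by positivity
  have hM0 : 0 ≤ M := (abs_nonneg _).trans (hM 0)
  rw [fderiv_cutoff]
  by_cases hx : x ∈ {x | t - 1 / (n + 1) ≤ ℓ x ∧ ℓ x ≤ t}
  · rw [indicator_of_mem hx]
    refine (neg_le_abs _).trans ?_
    rw [abs_mul, abs_mul, abs_neg, abs_of_pos hn, mul_assoc]
    have h3 : |ℓ v| ≤ ‖ℓ‖ :=
      (ℓ.le_opNorm v).trans (mul_le_of_le_one_right (norm_nonneg _) hv)
    exact mul_le_mul (hM _) (mul_le_mul_of_nonneg_left h3 hn.le) (by positivity) hM0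
  · rw [indicator_of_notMem hx, deriv_smoothTransition_eq_zero]
    · simp
    · rintro ⟨h1, h2⟩
      refine hx ⟨?_, ?_⟩
      · have : t - ℓ x ≤ 1 / (n + 1) := by rw [le_div_iff₀ hn]; linarith
        linarith
      · have := nonneg_of_mul_nonneg_right h1 hn
        linarith

/-- The product rule for `cutoff ℓ t n • φ`: the bound is uniform in `n` because the slope of the
cutoff is compensated by the width of its strip. -/
theorem integral_cutoff_mul_divergence_le {E : Set (EuclideanSpace ℝ (Fin N))}
    (hEP : perimeter E ≠ ∞) (ℓ : EuclideanSpace ℝ (Fin N) →L[ℝ] ℝ) {c : ℝ} (hEv : volume E ≠ ∞)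
    (hc : ∀ a b : ℝ, a ≤ b → volume.real (E ∩ {x | a ≤ ℓ x ∧ ℓ x ≤ b}) ≤ c * (b - a)) (t : ℝ)
    (n : ℕ) {M : ℝ} (hM : ∀ s, |deriv Real.smoothTransition s| ≤ M)
    {φ : EuclideanSpace ℝ (Fin N) → EuclideanSpace ℝ (Fin N)} (hφ : ContDiff ℝ 1 φ)
    (hφc : HasCompactSupport φ) (hφ1 : ∀ x, ‖φ x‖ ≤ 1) :
    ∫ x in E, cutoff ℓ t n x * divergence φ x ≤ (perimeter E).toReal + M * ‖ℓ‖ * c := by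
  have hfin : IsFiniteMeasure (volume.restrict E) := ⟨by simpa using hEv.lt_top⟩
  have hn : (0 : ℝ) < n + 1 := by positivity
  have hM0 : 0 ≤ M := (abs_nonneg _).trans (hM 0)
  have hint : Integrable (divergence φ) (volume.restrict E) :=
    (integrable_divergence hφ hφc).integrableOn
  set A : Set (EuclideanSpace ℝ (Fin N)) := {x | t - 1 / (n + 1) ≤ ℓ x ∧ ℓ x ≤ t}
  have hAm : MeasurableSet A :=
    (measurableSet_le measurable_const ℓ.continuous.measurable).inter
      (measurableSet_le ℓ.continuous.measurable measurable_const)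
  have hprod : ContDiff ℝ 1 fun x => cutoff ℓ t n x • φ x := (contDiff_cutoff ℓ t n).smul hφ
  have hprodc : HasCompactSupport fun x => cutoff ℓ t n x • φ x :=
    hφc.mono fun x hx => right_ne_zero_of_smul hx
  have h1 := integral_divergence_le_perimeter hEP hprod hprodc fun x => by
    rw [norm_smul]
    exact mul_le_one₀ (norm_cutoff_le ℓ t n x) (norm_nonneg _) (hφ1 x)
  have hdint : Integrable (divergence fun x => cutoff ℓ t n x • φ x) (volume.restrict E) :=
    (integrable_divergence hprod hprodc).integrableOn
  have hpt : ∀ x, cutoff ℓ t n x * divergence φ x ≤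
      divergence (fun x => cutoff ℓ t n x • φ x) x
        + A.indicator (fun _ => M * (n + 1) * ‖ℓ‖) x := by
    intro x
    rw [divergence_smul ((contDiff_cutoff ℓ t n).differentiable one_ne_zero x)
      (hφ.differentiable one_ne_zero x)]
    linarith [neg_fderiv_cutoff_le ℓ t n hM x (hφ1 x)]
  have hAint : Integrable (A.indicator fun _ => M * (n + 1) * ‖ℓ‖) (volume.restrict E) :=
    (integrable_const _).indicator hAm
  have hAc : volume.real (E ∩ A) ≤ c * (t - (t - 1 / (n + 1))) := by
    refine hc _ _ ?_
    have : (0 : ℝ) < 1 / (n + 1) := by positivity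
    linarith
  calc ∫ x in E, cutoff ℓ t n x * divergence φ x
      ≤ ∫ x in E, (divergence (fun x => cutoff ℓ t n x • φ x) x
          + A.indicator (fun _ => M * (n + 1) * ‖ℓ‖) x) := by
        refine integral_mono ?_ (hdint.add hAint) hpt
        exact hint.bdd_mul (c := 1) (contDiff_cutoff ℓ t n).continuous.aestronglyMeasurable
          (Filter.Eventually.of_forall (norm_cutoff_le ℓ t n))
    _ = (∫ x in E, divergence (fun x => cutoff ℓ t n x • φ x) x)
          + volume.real (E ∩ A) * (M * (n + 1) * ‖ℓ‖) := by
        rw [integral_add hdint hAint, integral_indicator_const _ hAm,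
          measureReal_restrict_apply hAm, inter_comm, smul_eq_mul]
    _ ≤ (perimeter E).toReal + c * (t - (t - 1 / (n + 1))) * (M * (n + 1) * ‖ℓ‖) :=
        add_le_add h1 (mul_le_mul_of_nonneg_right hAc (by positivity))
    _ = (perimeter E).toReal + M * ‖ℓ‖ * c := by
        rw [sub_sub_cancel]
        field_simp

/-- Cutting by a half-space `{ℓ < t}` preserves finiteness of the perimeter if the set meets the
strips `{a ≤ ℓ ≤ b}` in measure at most proportional to `b - a`: a field `φ` is multiplied by
cutoff functions, whose slopes of order `n + 1` live in strips of width `1 / (n + 1)`. -/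
theorem perimeter_inter_halfspace_ne_top {E : Set (EuclideanSpace ℝ (Fin N))}
    (hEP : perimeter E ≠ ∞) (ℓ : EuclideanSpace ℝ (Fin N) →L[ℝ] ℝ) {c : ℝ} (hEv : volume E ≠ ∞)
    (hc : ∀ a b : ℝ, a ≤ b → volume.real (E ∩ {x | a ≤ ℓ x ∧ ℓ x ≤ b}) ≤ c * (b - a)) (t : ℝ) :
    perimeter (E ∩ {x | ℓ x < t}) ≠ ∞ := by
  obtain ⟨M, hM⟩ := exists_bound_deriv_smoothTransition
  have hH : MeasurableSet {x | ℓ x < t} := measurableSet_lt ℓ.continuous.measurable measurable_const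
  refine ne_top_of_le_ne_top
    (ENNReal.ofReal_ne_top (r := (perimeter E).toReal + M * ‖ℓ‖ * c)) ?_
  refine iSup₂_le fun φ hφ => iSup₂_le fun hφc hφ1 => ENNReal.ofReal_le_ofReal ?_
  have hint : Integrable (divergence φ) (volume.restrict E) :=
    (integrable_divergence hφ hφc).integrableOn
  have hlim : Filter.Tendsto (fun n : ℕ => ∫ x in E, cutoff ℓ t n x * divergence φ x) Filter.atTop
      (nhds (∫ x in E ∩ {x | ℓ x < t}, divergence φ x)) := by
    rw [inter_comm, ← Measure.restrict_restrict hH, ← integral_indicator hH]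
    refine tendsto_integral_of_dominated_convergence (fun x => ‖divergence φ x‖) ?_ hint.norm ?_ ?_
    · exact fun n => ((contDiff_cutoff ℓ t n).continuous.mul
        (continuous_divergence hφ)).aestronglyMeasurable
    · refine fun n => Filter.Eventually.of_forall fun x => ?_
      rw [norm_mul]
      exact mul_le_of_le_one_left (norm_nonneg _) (norm_cutoff_le ℓ t n x)
    · refine Filter.Eventually.of_forall fun x => ?_
      convert (tendsto_cutoff ℓ t x).mul_const (divergence φ x) using 2
      by_cases hx : ℓ x < t <;> simp [indicator, hx]
  exact le_of_tendsto hlim (Filter.Eventually.of_forall fun n =>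
    integral_cutoff_mul_divergence_le hEP ℓ hEv hc t n hM hφ hφc hφ1)

theorem exists_volume_strip_le (R : ℝ) (hR : 0 ≤ R) (i : Fin N) :
    ∃ c : ℝ, 0 ≤ c ∧ ∀ a b : ℝ, a ≤ b →
      volume.real (Metric.closedBall (0 : EuclideanSpace ℝ (Fin N)) R ∩ {x | a ≤ x i ∧ x i ≤ b})
        ≤ c * (b - a) := by
  refine ⟨∏ j ∈ Finset.univ.erase i, 2 * R, by positivity, fun a b hab => ?_⟩
  set I : Fin N → Set ℝ := Function.update (fun _ => Icc (-R) R) i (Icc a b) with hI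
  have hsub : Metric.closedBall (0 : EuclideanSpace ℝ (Fin N)) R ∩ {x | a ≤ x i ∧ x i ≤ b}
      ⊆ (WithLp.ofLp : EuclideanSpace ℝ (Fin N) → Fin N → ℝ) ⁻¹' Set.pi univ I := by
    rintro x ⟨hx, hxi⟩ j -
    by_cases hj : j = i
    · subst hj
      simpa [hI] using hxi
    · have : |x j| ≤ R := (PiLp.norm_apply_le x j).trans (by simpa using hx)
      simpa [hI, hj] using abs_le.1 this
  have hImeas : MeasurableSet (Set.pi univ I) := by
    refine MeasurableSet.univ_pi fun j => ?_
    by_cases hj : j = i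
    · subst hj
      simp [hI]
    · simp [hI, hj]
  have hvol : volume ((WithLp.ofLp : EuclideanSpace ℝ (Fin N) → Fin N → ℝ) ⁻¹' Set.pi univ I)
      = ENNReal.ofReal ((∏ j ∈ Finset.univ.erase i, 2 * R) * (b - a)) := by
    rw [(PiLp.volume_preserving_ofLp (Fin N)).measure_preimage hImeas.nullMeasurableSet,
      volume_pi_pi, ← Finset.prod_erase_mul _ _ (Finset.mem_univ i), ENNReal.ofReal_mul
      (by positivity), ENNReal.ofReal_prod_of_nonneg (fun _ _ => by positivity)]
    congr 1
    · refine Finset.prod_congr rfl fun j hj => ?_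
      rw [hI, Function.update_of_ne (Finset.ne_of_mem_erase hj), Real.volume_Icc]
      congr 1
      ring
    · simp [hI]
  refine (measureReal_mono hsub (by rw [hvol]; exact ENNReal.ofReal_ne_top)).trans (le_of_eq ?_)
  rw [measureReal_def, hvol, ENNReal.toReal_ofReal]
  exact mul_nonneg (by positivity) (sub_nonneg.2 hab)

/-- A bounded set of positive measure is cut by some hyperplane into two parts of positive
measure, and these have finite perimeter if the set has. -/
theorem exists_cut (hN : 0 < N) {E : Set (EuclideanSpace ℝ (Fin N))}
    (hE : NullMeasurableSet E volume) (hb : Bornology.IsBounded E) (hE0 : 0 < volume E) :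
    ∃ A B : Set (EuclideanSpace ℝ (Fin N)), A ⊆ E ∧ B ⊆ E ∧ Disjoint A B ∧
      NullMeasurableSet A volume ∧ NullMeasurableSet B volume ∧ 0 < volume A ∧ 0 < volume B ∧
      (perimeter E ≠ ∞ → perimeter A ≠ ∞ ∧ perimeter B ≠ ∞) := by
  have hEv : volume E ≠ ∞ := hb.measure_lt_top.ne
  obtain ⟨R, hR0, hR⟩ := hb.subset_closedBall_lt 0 (0 : EuclideanSpace ℝ (Fin N))
  set i : Fin N := ⟨0, hN⟩
  obtain ⟨c, hc0, hc⟩ := exists_volume_strip_le R hR0.le i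
  have hcE : ∀ a b : ℝ, a ≤ b → volume.real (E ∩ {x | a ≤ x i ∧ x i ≤ b}) ≤ c * (b - a) :=
    fun a b hab => (measureReal_mono (inter_subset_inter_left _ hR)
      (ne_top_of_le_ne_top measure_closedBall_lt_top.ne (measure_mono inter_subset_left))).trans
      (hc a b hab)
  have hci : Continuous fun x : EuclideanSpace ℝ (Fin N) => x i := by fun_prop
  have hlt : ∀ t : ℝ, MeasurableSet {x : EuclideanSpace ℝ (Fin N) | x i < t} := fun t =>
    measurableSet_lt hci.measurable measurable_const
  have hsub : ∀ D : Set (EuclideanSpace ℝ (Fin N)), volume (E ∩ D) ≠ ∞ := fun D =>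
    ne_top_of_le_ne_top hEv (measure_mono inter_subset_left)
  set f : ℝ → ℝ := fun t => volume.real (E ∩ {x | x i < t}) with hf
  have hmono : ∀ s t, s ≤ t → f s ≤ f t := fun s t hst =>
    measureReal_mono (inter_subset_inter_right _ fun x (hx : x i < s) => hx.trans_le hst) (hsub _)
  have hlip : ∀ s t, s ≤ t → f t ≤ f s + c * (t - s) := by
    intro s t hst
    have : E ∩ {x | x i < t} ⊆ (E ∩ {x | x i < s}) ∪ (E ∩ {x | s ≤ x i ∧ x i ≤ t}) := by
      rintro x ⟨hxE, hx⟩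
      rcases lt_or_ge (x i) s with h | h
      · exact Or.inl ⟨hxE, h⟩
      · exact Or.inr ⟨hxE, h, le_of_lt hx⟩
    refine (measureReal_mono this ?_).trans ((measureReal_union_le _ _).trans ?_)
    · exact (measure_union_lt_top (hsub _).lt_top (hsub _).lt_top).ne
    · exact add_le_add_right (hcE s t hst) _
  have hcont : Continuous f := by
    refine (LipschitzWith.of_le_add_mul (K := c.toNNReal) fun s t => ?_).continuous
    rw [Real.coe_toNNReal c hc0, Real.dist_eq]
    rcases le_total s t with h | h
    · exact (hmono s t h).trans (le_add_of_nonneg_right (by positivity))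
    · rw [abs_of_nonneg (sub_nonneg.2 h)]
      exact hlip t s h
  have hcoord : ∀ x ∈ E, |x i| ≤ R := fun x hx =>
    (PiLp.norm_apply_le x i).trans (by simpa using hR hx)
  have hpos : 0 < volume.real E := ENNReal.toReal_pos hE0.ne' hEv
  have hf0 : f (-R) = 0 := by
    have : E ∩ {x | x i < -R} = ∅ := by
      refine eq_empty_of_forall_notMem fun x hx => ?_
      have h1 := (abs_le.1 (hcoord x hx.1)).1
      have h2 : x i < -R := hx.2
      linarith
    simp [hf, this]
  have hf1 : f (R + 1) = volume.real E := by
    have : E ∩ {x | x i < R + 1} = E := by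
      refine inter_eq_left.2 fun x hx => ?_
      have h1 := (abs_le.1 (hcoord x hx)).2
      change x i < R + 1
      linarith
    simp only [hf, this]
  obtain ⟨t, -, ht⟩ := intermediate_value_Icc (show -R ≤ R + 1 by linarith) hcont.continuousOn
    (show volume.real E / 2 ∈ Icc (f (-R)) (f (R + 1)) by
      rw [hf0, hf1]
      constructor <;> linarith)
  have hgt : MeasurableSet {x : EuclideanSpace ℝ (Fin N) | t < x i} :=
    measurableSet_lt measurable_const hci.measurable
  refine ⟨E ∩ {x | x i < t}, E ∩ {x | t < x i}, inter_subset_left, inter_subset_left, ?_,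
    hE.inter (hlt t).nullMeasurableSet, hE.inter hgt.nullMeasurableSet, ?_, ?_, fun hP => ⟨?_, ?_⟩⟩
  · exact Set.disjoint_left.2 fun x hx hx' => lt_asymm (show x i < t from hx.2) hx'.2
  · refine (ENNReal.toReal_pos_iff.1 (?_ : 0 < f t)).1
    rw [ht]
    linarith
  · -- the hyperplane itself is a null set
    refine (ENNReal.toReal_pos_iff.1 (?_ : 0 < volume.real (E ∩ {x | t < x i}))).1
    have hcov : E ⊆ (E ∩ {x | x i < t}) ∪ ((E ∩ {x | t ≤ x i ∧ x i ≤ t}) ∪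
        (E ∩ {x | t < x i})) := by
      intro x hx
      rcases lt_trichotomy (x i) t with h | h | h
      · exact Or.inl ⟨hx, h⟩
      · exact Or.inr (Or.inl ⟨hx, h.ge, h.le⟩)
      · exact Or.inr (Or.inr ⟨hx, h⟩)
    have h1 := measureReal_mono hcov (measure_union_lt_top (hsub _).lt_top
      (measure_union_lt_top (hsub _).lt_top (hsub _).lt_top)).ne (μ := volume)
    have h2 := measureReal_union_le (μ := volume) (E ∩ {x | x i < t})
      ((E ∩ {x | t ≤ x i ∧ x i ≤ t}) ∪ (E ∩ {x | t < x i}))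
    have h3 := measureReal_union_le (μ := volume) (E ∩ {x | t ≤ x i ∧ x i ≤ t})
      (E ∩ {x | t < x i})
    have h4 := hcE t t le_rfl
    change volume.real (E ∩ {x | x i < t}) = _ at ht
    rw [sub_self, mul_zero] at h4
    linarith
  · exact perimeter_inter_halfspace_ne_top hP (EuclideanSpace.proj i) hEv hcE t
  · have := perimeter_inter_halfspace_ne_top hP (-(EuclideanSpace.proj (𝕜 := ℝ) i)) hEv (c := c)
      (fun a b hab => ?_) (-t)
    · convert this using 5
      simp
    · have h1 := hcE (-b) (-a) (by linarith)
      rw [show -a - -b = b - a by ring] at h1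
      convert h1 using 5
      simp only [neg_apply, PiLp.proj_apply]
      constructor <;> rintro ⟨h1, h2⟩ <;> constructor <;> linarith

/-- Every bounded set of positive measure contains admissible tuples of all lengths, whose
perimeters are finite if that of the set is. -/
theorem exists_isAdmissible (hN : 0 < N) (k : ℕ) :
    ∀ E : Set (EuclideanSpace ℝ (Fin N)), NullMeasurableSet E volume → Bornology.IsBounded E →
      0 < volume E → ∃ F : Fin k → Set (EuclideanSpace ℝ (Fin N)), IsAdmissible E F ∧
        (perimeter E ≠ ∞ → ∀ i, perimeter (F i) ≠ ∞) := by
  induction k with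
  | zero =>
    exact fun E _ _ _ => ⟨Fin.elim0, ⟨fun i => i.elim0, fun i => i.elim0, fun i => i.elim0,
      fun i => i.elim0⟩, fun _ i => i.elim0⟩
  | succ k ih =>
    intro E hE hb hE0
    obtain ⟨A, B, hAE, hBE, hAB, hA, hB, hA0, hB0, hP⟩ := exists_cut hN hE hb hE0
    obtain ⟨F, hF, hFP⟩ := ih A hA (hb.subset hAE) hA0
    refine ⟨Fin.cons B F, ⟨?_, ?_, ?_, ?_⟩, fun h => ?_⟩
    · exact Fin.cases hBE fun i => (hF.subset i).trans hAE
    · exact Fin.cases hB hF.measurable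
    · exact Fin.cases hB0 hF.pos
    · intro i j
      induction i using Fin.cases with
      | zero =>
        induction j using Fin.cases with
        | zero => exact fun h => absurd rfl h
        | succ j => exact fun _ => (hAB.mono_left (hF.subset j)).symm
      | succ i =>
        induction j using Fin.cases with
        | zero => exact fun _ => hAB.mono_left (hF.subset i)
        | succ j => exact fun h => hF.disjoint fun hij => h (congrArg Fin.succ hij)
    · exact Fin.cases (hP h).2 (hFP (hP h).1)

end Cutting

/-! ### Adjusted tuples -/

section Adjusted

variable {N k : ℕ}

theorem cheegerConst_le {Ω : Set (EuclideanSpace ℝ (Fin N))}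
    {E : Fin k → Set (EuclideanSpace ℝ (Fin N))} (hE : IsAdmissible Ω E) :
    cheegerConst k Ω ≤ ⨆ i, ratio (E i) :=
  iInf₂_le E hE

theorem IsAdmissible.mono {Ω Ω' : Set (EuclideanSpace ℝ (Fin N))}
    {E : Fin k → Set (EuclideanSpace ℝ (Fin N))} (hE : IsAdmissible Ω E) (h : Ω ⊆ Ω') :
    IsAdmissible Ω' E :=
  ⟨fun i => (hE.subset i).trans h, hE.measurable, hE.pos, hE.disjoint⟩

/-- A tuple is `n`-adjusted for all `n` if none of its subtuples can be improved in the complement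
of the remaining sets. -/
theorem isAdjusted_of_forall_le {Ω : Set (EuclideanSpace ℝ (Fin N))}
    {E : Fin k → Set (EuclideanSpace ℝ (Fin N))} (hE : IsAdmissible Ω E)
    (hopt : ∀ (l : ℕ) (σ : Fin l → Fin k), Function.Injective σ →
      ∀ F : Fin l → Set (EuclideanSpace ℝ (Fin N)),
        IsAdmissible (Ω \ ⋃ j ∈ (range σ)ᶜ, E j) F → ⨆ i, ratio (E (σ i)) ≤ ⨆ i, ratio (F i))
    (n : ℕ) : IsAdjusted Ω E n := by
  induction n with
  | zero =>
    refine ⟨hE, le_antisymm (le_iInf₂ fun F hF => ?_) (cheegerConst_le hE)⟩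
    refine hopt k id Function.injective_id F ?_
    simpa using hF
  | succ n ih =>
    refine ⟨ih, fun σ hσ => ?_⟩
    have hsub : ⋃ i, E (σ i) ⊆ Ω \ ⋃ j ∈ (range σ)ᶜ, E j := by
      refine iUnion_subset fun i x hx => ⟨hE.subset _ hx, fun hx' => ?_⟩
      obtain ⟨j, hj, hxj⟩ := mem_iUnion₂.1 hx'
      have hne : σ i ≠ j := fun h => hj ⟨i, h⟩
      exact Set.disjoint_left.1 (hE.disjoint hne) hx hxj
    have hadm : IsAdmissible (⋃ i, E (σ i)) fun i => E (σ i) :=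
      ⟨fun i => subset_iUnion (fun i => E (σ i)) i, fun i => hE.measurable _, fun i => hE.pos _,
        fun i j hij => hE.disjoint (hσ.ne hij)⟩
    have h1 : cheegerConst (n + 1) (⋃ i, E (σ i)) ≤ ⨆ i, ratio (E (σ i)) := cheegerConst_le hadm
    have h2 : ⨆ i, ratio (E (σ i)) ≤ cheegerConst (n + 1) (Ω \ ⋃ j ∈ (range σ)ᶜ, E j) :=
      le_iInf₂ fun F hF => hopt (n + 1) σ hσ F hF
    have h3 : cheegerConst (n + 1) (Ω \ ⋃ j ∈ (range σ)ᶜ, E j)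
        ≤ cheegerConst (n + 1) (⋃ i, E (σ i)) :=
      le_iInf₂ fun F hF => cheegerConst_le (hF.mono hsub)
    exact ⟨le_antisymm h3 (h1.trans h2), le_antisymm h1 (h2.trans h3)⟩

/-- Replacing a subtuple by a tuple in the complement of the remaining sets gives again an
admissible tuple. -/
theorem IsAdmissible.extend {l : ℕ} {Ω : Set (EuclideanSpace ℝ (Fin N))}
    {E : Fin k → Set (EuclideanSpace ℝ (Fin N))} (hE : IsAdmissible Ω E) {σ : Fin l → Fin k}
    (hσ : Function.Injective σ) {F : Fin l → Set (EuclideanSpace ℝ (Fin N))}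
    (hF : IsAdmissible (Ω \ ⋃ j ∈ (range σ)ᶜ, E j) F) :
    IsAdmissible Ω (Function.extend σ F E) := by
  have hdisj : ∀ i, ∀ j ∉ range σ, Disjoint (F i) (E j) := fun i j hj =>
    Set.disjoint_left.2 fun x hx hxj => (hF.subset i hx).2 (mem_biUnion hj hxj)
  have hall : ∀ {p : Set (EuclideanSpace ℝ (Fin N)) → Prop}, (∀ i, p (F i)) → (∀ j, p (E j)) →
      ∀ j, p (Function.extend σ F E j) := by
    intro p h1 h2 j
    by_cases hj : ∃ i, σ i = j
    · obtain ⟨i, rfl⟩ := hj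
      rw [hσ.extend_apply]
      exact h1 i
    · rw [Function.extend_apply' _ _ _ hj]
      exact h2 j
  refine ⟨hall (p := (· ⊆ Ω)) (fun i => (hF.subset i).trans sdiff_subset) hE.subset,
    hall (p := (NullMeasurableSet · volume)) hF.measurable hE.measurable,
    hall (p := (0 < volume ·)) hF.pos hE.pos, fun a b hab => ?_⟩
  by_cases ha : a ∈ range σ <;> by_cases hb : b ∈ range σ
  · obtain ⟨i, rfl⟩ := ha
    obtain ⟨j, rfl⟩ := hb
    simp only [hσ.extend_apply]
    exact hF.disjoint fun h => hab (congrArg σ h)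
  · obtain ⟨i, rfl⟩ := ha
    simp only [hσ.extend_apply, Function.extend_apply' _ _ _ hb]
    exact hdisj i b hb
  · obtain ⟨j, rfl⟩ := hb
    simp only [hσ.extend_apply, Function.extend_apply' _ _ _ ha]
    exact (hdisj j a ha).symm
  · simp only [Function.extend_apply' _ _ _ ha, Function.extend_apply' _ _ _ hb]
    exact hE.disjoint hab

/-- If some admissible tuple has finite quotients, a lexicographic minimizer exists by compactness,
and none of its subtuples can be improved. -/
theorem exists_forall_isAdjusted_of_ratio_ne_top {Ω : Set (EuclideanSpace ℝ (Fin N))}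
    (hb : Bornology.IsBounded Ω) (hΩ : NullMeasurableSet Ω volume)
    {E₀ : Fin k → Set (EuclideanSpace ℝ (Fin N))} (hE₀ : IsAdmissible Ω E₀)
    (hfin : ∀ i, ratio (E₀ i) ≠ ∞) :
    ∃ E : Fin k → Set (EuclideanSpace ℝ (Fin N)), ∀ n, IsAdjusted Ω E n := by
  have hΩv : volume Ω ≠ ∞ := hb.measure_lt_top.ne
  have hvol : ∀ D ⊆ Ω, volume D ≠ ∞ := fun D hD => ne_top_of_le_ne_top hΩv (measure_mono hD)
  obtain ⟨C, hC⟩ : ∃ C : NNReal, ∀ i, ratio (E₀ i) ≤ C := by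
    refine ⟨Finset.univ.sup fun i => (ratio (E₀ i)).toNNReal, fun i => ?_⟩
    rw [← ENNReal.coe_toNNReal (hfin i), ENNReal.coe_le_coe]
    exact Finset.le_sup (f := fun i => (ratio (E₀ i)).toNNReal) (Finset.mem_univ i)
  obtain ⟨δ, hδ, hδE⟩ := exists_le_volume_of_ratio_le (N := N) C
  have hmem : ∀ F : Fin k → Set (EuclideanSpace ℝ (Fin N)), IsAdmissible Ω F →
      (∀ i, ratio (F i) ≤ C) → (fun i => chi (F i)) ∈ competitors Ω δ C := fun F hF hFC =>
    hF.chi_mem_competitors hΩ hΩv (fun i => hδE _ (hF.measurable i) (hvol _ (hF.subset i))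
      (hF.pos i) (hFC i)) hFC
  have hquot : ∀ F : Fin k → Set (EuclideanSpace ℝ (Fin N)), IsAdmissible Ω F →
      ∀ i, quotient (chi (F i)) = ratio (F i) := fun F hF i =>
    quotient_chi (hF.measurable i) (hvol _ (hF.subset i)) (hF.pos i)
  obtain ⟨f, hf, hmin⟩ := exists_lexicographic_min (isCompact_competitors (k := k) hΩ hb hδ C)
    ⟨_, hmem E₀ hE₀ hC⟩ (r := fun i f => quotient (f i)) fun i =>
      (lowerSemicontinuousOn_quotient hδ).comp (continuous_apply i).continuousOn
        fun f hf => (hf.2.2 i).1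
  obtain ⟨E, hE, hEf⟩ := exists_isAdmissible_of_mem_competitors hΩ hΩv hδ hf
  have hEq : ∀ i, quotient (f i) = ratio (E i) := fun i => by rw [← hEf i, hquot E hE i]
  have hEC : ∀ i, ratio (E i) ≤ C := fun i => by
    rw [← hEq i]
    exact (hf.2.2 i).2
  refine ⟨E, isAdjusted_of_forall_le hE fun l σ hσ F hF => ?_⟩
  by_contra hcon
  push Not at hcon
  set M := ⨆ i, ratio (E (σ i)) with hM
  have hFM : ∀ i, ratio (F i) < M := fun i => (le_iSup (fun i => ratio (F i)) i).trans_lt hcon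
  have hMC : M ≤ C := iSup_le fun i => hEC (σ i)
  have hG := hE.extend hσ hF
  have hGin : ∀ i, Function.extend σ F E (σ i) = F i := fun i => hσ.extend_apply _ _ i
  have hGout : ∀ j ∉ range σ, Function.extend σ F E j = E j := fun j hj =>
    Function.extend_apply' _ _ _ hj
  have hGC : ∀ j, ratio (Function.extend σ F E j) ≤ C := by
    intro j
    by_cases hj : j ∈ range σ
    · obtain ⟨i, rfl⟩ := hj
      rw [hGin]
      exact (hFM i).le.trans hMC
    · rw [hGout j hj]
      exact hEC j
  have hlt := hmin _ (hmem _ hG hGC) (range σ) M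
    (fun j hj => by rw [hquot _ hG, hEq, hGout j hj])
    (by
      rintro _ ⟨i, rfl⟩
      rw [hquot _ hG, hGin]
      exact hFM i)
  have hl : Nonempty (Fin l) := by
    by_contra h
    rw [not_nonempty_iff] at h
    simp [hM] at hcon
  obtain ⟨i, hi⟩ := exists_eq_ciSup_of_finite (f := fun i => ratio (E (σ i)))
  have := hlt (σ i) (mem_range_self i)
  rw [hEq] at this
  exact absurd (hi.trans hM.symm) this.ne

/-- If no subset of `Ω` of positive measure has finite perimeter, all quotients are infinite and
every admissible tuple is adjusted; otherwise cutting such a subset by hyperplanes provides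
an admissible tuple with finite quotients. -/
theorem exists_forall_isAdjusted (hN : 0 < N) {Ω : Set (EuclideanSpace ℝ (Fin N))}
    (hb : Bornology.IsBounded Ω) (hΩ : NullMeasurableSet Ω volume) (hΩ0 : 0 < volume Ω) (k : ℕ) :
    ∃ E : Fin k → Set (EuclideanSpace ℝ (Fin N)), ∀ n, IsAdjusted Ω E n := by
  by_cases h : ∃ D ⊆ Ω, NullMeasurableSet D volume ∧ 0 < volume D ∧ perimeter D ≠ ∞
  · obtain ⟨D, hDΩ, hD, hD0, hDP⟩ := h
    obtain ⟨F, hF, hFP⟩ := exists_isAdmissible hN k D hD (hb.subset hDΩ) hD0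
    exact exists_forall_isAdjusted_of_ratio_ne_top hb hΩ (hF.mono hDΩ) fun i =>
      ENNReal.div_ne_top (hFP hDP i) (hF.pos i).ne'
  · push Not at h
    obtain ⟨E, hE, -⟩ := exists_isAdmissible hN k Ω hΩ hb hΩ0
    refine ⟨E, isAdjusted_of_forall_le hE fun l σ _ F hF => iSup_le fun i => ?_⟩
    have hFi : ratio (F i) = ∞ := by
      have hFΩ : F i ⊆ Ω := (hF.subset i).trans sdiff_subset
      rw [ratio, h (F i) hFΩ (hF.measurable i) (hF.pos i)]
      exact ENNReal.top_div_of_ne_top (hb.subset hFΩ).measure_lt_top.ne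
    exact le_top.trans (hFi.symm.le.trans (le_iSup (fun i => ratio (F i)) i))

end Adjusted

end Cheeger

theorem mainTheorem2 (N : ℕ) (hN : 2 ≤ N) (Ω : Set (EuclideanSpace ℝ (Fin N)))
    (hΩ_bdd : Bornology.IsBounded Ω) (hΩ_meas : NullMeasurableSet Ω volume)
    (hΩ_pos : 0 < volume Ω) (k n : ℕ) (hn : 1 ≤ n) (hnk : n ≤ k) :
    ∃ E : Fin k → Set (EuclideanSpace ℝ (Fin N)), Cheeger.IsAdjusted Ω E n := by
  obtain ⟨E, hE⟩ := Cheeger.exists_forall_isAdjusted (by omega) hΩ_bdd hΩ_meas hΩ_pos k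
  exact ⟨E, hE n⟩
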